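/- Let $p\ge 1$, $n=2p$, $V=\mathbb C^{n}$, and let $J=\begin{pmatrix}0&I_p\\-I_p&0\end{pmatrix}$ be the standard symplectic form. Identify $\Lambda^2V$ and $S^2V$ with the spaces of skew-symmetric and of symmetric complex $n\times n$ matrices, and consider the rational map $$\phi:\mathbb P(\Lambda^2V\times\Lambda^2V)\dashrightarrow\mathbb P(S^2V),\qquad [A,B]\mapsto[AJB-BJA],$$ defined at the points $[A,B]$ with $AJB-BJA\neq 0$; its image is the set of values at these points. a) For $n=2$, $\phi$ is nowhere defined. b) For $n=4$, the image of $\phi$ is the Grassmannian $\mathbb G(2,5)$ in $\mathbb P^9=\mathbb P(S^2\mathbb C^4)$: there is a linear isomorphism $\Lambda^2\mathbb C^5\cong S^2\mathbb C^4$ whose projectivization carries the Plücker-embedded Grassmannian of $2$-dimensional subspaces of $\mathbb C^5$ onto the image of $\phi$. c) For $n=6$, the image of $\phi$ is an irreducible hypersurface of degree $4$ in $\mathbb P^{20}=\mathbb P(S^2\mathbb C^6)$, namely the hypersurface $$\gamma_4^2-4\gamma_2=0,$$ where $\gamma_k(S)$ denotes the coefficient of $t^k$ in $\det(S-tJ)$;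 the polynomial $\gamma_4^2-4\gamma_2$ in the entries of the symmetric matrix $S$ is homogeneous of degree $4$ and irreducible. d) For every even $n\ge 8$, $\phi$ is locally of maximal rank: on a dense Zariski-open subset of $\mathbb P(\Lambda^2V\times\Lambda^2V)$ the map $\phi$ is defined and the derivative of $(A,B)\mapsto AJB-BJA$, as a linear map $\Lambda^2V\times\Lambda^2V\to S^2V$, is surjective. In particular, $\phi$ is dominant: its image is Zariski dense in $\mathbb P(S^2V)$. -/

import Mathlib

open Matrix
open scoped LinearAlgebra.Projectivization Topology

noncomputable section

/-- The index set of the coordinates of `V = ℂⁿ`, `n = 2p`: two consecutive blocks of length `p`. -/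
abbrev Idx (p : ℕ) : Type := Fin p ⊕ Fin p

/-- The standard symplectic form `J = [0, I; -I, 0]` on `ℂ²ᵖ`. -/
def stdJ (p : ℕ) : Matrix (Idx p) (Idx p) ℂ := Matrix.fromBlocks 0 1 (-1) 0

/-- `Λ²V`, the space of skew-symmetric `2p × 2p` complex matrices. -/
def SkewMat (p : ℕ) : Submodule ℂ (Matrix (Idx p) (Idx p) ℂ) where
  carrier := {A | Aᵀ = -A}
  zero_mem' := by simp
  add_mem' := by
    intro A B hA hB
    simp only [Set.mem_ofPred_eq] at *
    rw [transpose_add, hA, hB, neg_add]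
  smul_mem' := by
    intro c A hA
    simp only [Set.mem_ofPred_eq] at *
    rw [transpose_smul, hA, smul_neg]

/-- `S²V`, the space of symmetric `2p × 2p` complex matrices. -/
def SymMat (p : ℕ) : Submodule ℂ (Matrix (Idx p) (Idx p) ℂ) where
  carrier := {S | Sᵀ = S}
  zero_mem' := by simp
  add_mem' := by
    intro A B hA hB
    simp only [Set.mem_ofPred_eq] at *
    rw [transpose_add, hA, hB]
  smul_mem' := by
    intro c A hA
    simp only [Set.mem_ofPred_eq] at *
    rw [transpose_smul, hA]

theorem stdJ_transpose (p : ℕ) : (stdJ p)ᵀ = -stdJ p := by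
  simp [stdJ, fromBlocks_transpose, fromBlocks_neg]

theorem bracket_mem (p : ℕ) (A B : SkewMat p) :
    A.1 * stdJ p * B.1 - B.1 * stdJ p * A.1 ∈ SymMat p := by
  have hA : (A.1)ᵀ = -A.1 := A.2
  have hB : (B.1)ᵀ = -B.1 := B.2
  show (A.1 * stdJ p * B.1 - B.1 * stdJ p * A.1)ᵀ = A.1 * stdJ p * B.1 - B.1 * stdJ p * A.1
  simp only [transpose_sub, transpose_mul, hA, hB, stdJ_transpose]
  simp only [neg_mul, mul_neg, neg_neg, Matrix.mul_assoc]
  abel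

/-- The map `(A, B) ↦ AJB - BJA` from `Λ²V × Λ²V` to `S²V`. -/
def phiLift (p : ℕ) (x : SkewMat p × SkewMat p) : SymMat p :=
  ⟨x.1.1 * stdJ p * x.2.1 - x.2.1 * stdJ p * x.1.1, bracket_mem p x.1 x.2⟩

theorem phiLift_smul (p : ℕ) (c : ℂ) (x : SkewMat p × SkewMat p) :
    phiLift p (c • x) = (c * c) • phiLift p x := by
  apply Subtype.ext
  simp [phiLift, smul_sub, smul_smul]

/-- The rational map `φ : ℙ(Λ²V × Λ²V) ⇢ ℙ(S²V)`, `[A, B] ↦ [AJB - BJA]`, as a partial function: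
it is defined at `[A, B]` exactly when `AJB - BJA ≠ 0`. -/
def phi (p : ℕ) : ℙ ℂ (SkewMat p × SkewMat p) →. ℙ ℂ (SymMat p) := fun x =>
  ⟨phiLift p x.rep ≠ 0, fun h => Projectivization.mk ℂ (phiLift p x.rep) h⟩

/-- The partial function `phi` does not depend on the chosen representative of a point. -/
theorem mem_phi_mk (p : ℕ) (x : SkewMat p × SkewMat p) (hx : x ≠ 0) (y : ℙ ℂ (SymMat p)) :
    y ∈ phi p (Projectivization.mk ℂ x hx) ↔
      ∃ h : phiLift p x ≠ 0, Projectivization.mk ℂ (phiLift p x) h = y := by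
  obtain ⟨a, ha⟩ := Projectivization.exists_smul_eq_mk_rep ℂ x hx
  have key : phiLift p (Projectivization.mk ℂ x hx).rep = ((a : ℂ) * a) • phiLift p x := by
    rw [← ha, ← phiLift_smul]; rfl
  have ha0 : (a : ℂ) * a ≠ 0 := mul_ne_zero a.ne_zero a.ne_zero
  constructor
  · rintro ⟨h, rfl⟩
    change phiLift p (Projectivization.mk ℂ x hx).rep ≠ 0 at h
    have h' : phiLift p x ≠ 0 := fun h0 => h (by rw [key, h0, smul_zero])
    refine ⟨h', ?_⟩
    refine ((Projectivization.mk_eq_mk_iff' ℂ _ _ _ _).2 ⟨(((a : ℂ) * a))⁻¹, ?_⟩)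
    rw [key, smul_smul, inv_mul_cancel₀ ha0, one_smul]
  · rintro ⟨h, rfl⟩
    have h' : phiLift p (Projectivization.mk ℂ x hx).rep ≠ 0 := by
      rw [key]; exact smul_ne_zero ha0 h
    refine ⟨h', ?_⟩
    refine ((Projectivization.mk_eq_mk_iff' ℂ _ _ _ _).2 ⟨(a : ℂ) * a, ?_⟩)
    rw [key]

/-- The Grassmannian of `k`-dimensional subspaces of `ℂᵐ` in its Plücker embedding: the points of
`ℙ(⋀ᵏ ℂᵐ)` spanned by `v₁ ∧ ⋯ ∧ vₖ` with `v₁, …, vₖ` linearly independent. -/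
def pluckerGrassmannian (k m : ℕ) : Set (ℙ ℂ (⋀[ℂ]^k (Fin m → ℂ))) :=
  {x | ∃ v : Fin k → (Fin m → ℂ), LinearIndependent ℂ v ∧
    x.submodule = Submodule.span ℂ {exteriorPower.ιMulti ℂ k v}}

/-- The generic symmetric matrix, with one variable for each unordered pair of indices. -/
def genericSym (p : ℕ) : Matrix (Idx p) (Idx p) (MvPolynomial (Sym2 (Idx p)) ℂ) :=
  Matrix.of fun i j => MvPolynomial.X s(i, j)

/-- `γ_k`, the coefficient of `tᵏ` in `det (S - tJ)`, as a polynomial in the entries of the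
symmetric matrix `S`. -/
def gammaPoly (p k : ℕ) : MvPolynomial (Sym2 (Idx p)) ℂ :=
  ((genericSym p).map Polynomial.C -
    (Polynomial.X : Polynomial (MvPolynomial (Sym2 (Idx p)) ℂ)) •
      (stdJ p).map fun z => Polynomial.C (MvPolynomial.C z)).det.coeff k

/-- The entries of a symmetric matrix, indexed by unordered pairs. -/
def symEntries {p : ℕ} (S : SymMat p) : Sym2 (Idx p) → ℂ :=
  Sym2.lift ⟨fun i j => S.1 i j, fun i j => by
    have h : (S.1)ᵀ = S.1 := S.2
    exact (congrFun (congrFun h j) i)⟩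

/-- The value of `γ_k` at `S` is the coefficient of `tᵏ` in `det (S - tJ)`. -/
theorem eval_gammaPoly (p k : ℕ) (S : SymMat p) :
    MvPolynomial.eval (symEntries S) (gammaPoly p k) =
      ((S.1).map Polynomial.C - (Polynomial.X : Polynomial ℂ) • (stdJ p).map Polynomial.C).det.coeff k := by
  rw [gammaPoly, ← Polynomial.coeff_map, ← Polynomial.coe_mapRingHom, RingHom.map_det]
  congr 2
  ext1 i j
  simp [genericSym, symEntries, Matrix.map_apply]

/-- The locus in `ℙ(S²V)` where a homogeneous polynomial `F` in the entries of a symmetric matrix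
vanishes. -/
def symZeroLocus (p : ℕ) (F : MvPolynomial (Sym2 (Idx p)) ℂ) : Set (ℙ ℂ (SymMat p)) :=
  {x | MvPolynomial.eval (symEntries x.rep) F = 0}

/-- The Zariski topology on `ℙ(M)`, generated by the complements of the zero loci of homogeneous
polynomials. A polynomial on `M` is written as a polynomial in linear forms on `M`. -/
@[reducible] def zariskiTopology (M : Type*) [AddCommGroup M] [Module ℂ M] : TopologicalSpace (ℙ ℂ M) :=
  TopologicalSpace.generateFrom
    {U | ∃ (d : ℕ) (P : MvPolynomial (Module.Dual ℂ M) ℂ), P.IsHomogeneous d ∧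
      U = {x | MvPolynomial.eval (fun l : Module.Dual ℂ M => l x.rep) P ≠ 0}}

/-- `φ` is submersive at the pair `(A, B)`: the complex derivative of `(A, B) ↦ AJB - BJA`, a linear
map `Λ²V × Λ²V → S²V`, is surjective. As `φ` is homogeneous, `AJB - BJA` lies in the range of this
derivative, so where it is nonzero this says that the differential of `φ` as a map of projective
spaces is surjective. -/
def IsSubmersiveAt (p : ℕ) (x : SkewMat p × SkewMat p) : Prop :=
  Function.Surjective (fderiv ℂ (phiLift p) x)

end

noncomputable section

/-! Put X = AJ and Y = BJ. Then (AJB - BJA)J = XY - YX, so φ is a commutator map whose values,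
multiplied by J, lie in the symplectic Lie algebra. Congruence A ↦ gAgᵀ by a symplectic g conjugates
AJ, and φ is equivariant; everything may therefore be computed in normal forms.

For n = 2 every skew matrix is a multiple of J. For n = 4 the skew matrices split as ℂ⁵ ⊕ ℂJ; J is
in the radical of the bracket, and the induced map Λ²ℂ⁵ → S²ℂ⁴ is an isomorphism
(`bracketLinear_bijective`), so the values of the bracket are the images of the decomposable
bivectors.

For n = 6 the spectrum of SJ is ±a, ±b, ±c, and γ₄² - 4γ₂ = -(a+b+c)(a+b-c)(a-b+c)(-a+b+c) by
Heron's identity: the quartic vanishes exactly when signs can be chosen with a + b + c = 0. A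
generic A is congruent to `skewDiag d`, and its brackets have no entries inside the three hyperbolic
planes, which forces the quartic to vanish; continuity covers every A (`IsBracket.quartic_eq_zero`).
Conversely, S is brought to the block form [N, M; Mᵀ, 0] with M upper triangular of trace zero, and
A, B are sought in the same shape: the condition becomes M = [d, a] together with an equation for N
linear in the remaining blocks (`isBracket_parabolic`). Irreducibility follows from a plane section
x⁴ + 4y.

For n ≥ 8, trace duality identifies the cokernel of the derivative at (A, B) with the symmetric Q
such that J⁻¹Q commutes with AJ and BJ. An explicit pair has no such Q ≠ 0
(`eq_zero_of_commute_pair`). Surjectivity is detected by a nonvanishing determinant, hence holds on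
a dense open set, and the open mapping property at one point gives dominance. -/

theorem stdJ_eq_neg_J (p : ℕ) : stdJ p = -Matrix.J (Fin p) ℂ := by
  simp [stdJ, Matrix.J, fromBlocks_neg]

theorem stdJ_mul_stdJ (p : ℕ) : stdJ p * stdJ p = -1 := by
  simp [stdJ_eq_neg_J, Matrix.J_squared]

/-! ### Symplectic congruence and brackets -/

theorem mem_symplecticGroup_iff {p : ℕ} {g : Matrix (Idx p) (Idx p) ℂ} :
    g ∈ symplecticGroup (Fin p) ℂ ↔ g * stdJ p * gᵀ = stdJ p := by
  rw [SymplecticGroup.mem_iff, stdJ_eq_neg_J]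
  simp

theorem transpose_mul_stdJ_mul {p : ℕ} {g : Matrix (Idx p) (Idx p) ℂ}
    (hg : g ∈ symplecticGroup (Fin p) ℂ) : gᵀ * stdJ p * g = stdJ p := by
  simpa using mem_symplecticGroup_iff.1 (SymplecticGroup.transpose_mem hg)

/-- A matrix of the form `AJB - BJA` with `A` and `B` skew-symmetric. -/
def IsBracket {p : ℕ} (S : Matrix (Idx p) (Idx p) ℂ) : Prop :=
  ∃ A B : Matrix (Idx p) (Idx p) ℂ, Aᵀ = -A ∧ Bᵀ = -B ∧
    A * stdJ p * B - B * stdJ p * A = S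

theorem bracket_congr {p : ℕ} {g : Matrix (Idx p) (Idx p) ℂ}
    (hg : g ∈ symplecticGroup (Fin p) ℂ) (A B : Matrix (Idx p) (Idx p) ℂ) :
    (g * A * gᵀ) * stdJ p * (g * B * gᵀ) - (g * B * gᵀ) * stdJ p * (g * A * gᵀ) =
      g * (A * stdJ p * B - B * stdJ p * A) * gᵀ := by
  have key : ∀ A B : Matrix (Idx p) (Idx p) ℂ,
      (g * A * gᵀ) * stdJ p * (g * B * gᵀ) = g * (A * stdJ p * B) * gᵀ := by
    intro A B
    calc (g * A * gᵀ) * stdJ p * (g * B * gᵀ)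
        = g * A * (gᵀ * stdJ p * g) * B * gᵀ := by simp only [Matrix.mul_assoc]
      _ = _ := by rw [transpose_mul_stdJ_mul hg]; simp only [Matrix.mul_assoc]
  rw [key, key, Matrix.mul_sub, Matrix.sub_mul]

theorem IsBracket.congr {p : ℕ} {S g : Matrix (Idx p) (Idx p) ℂ} (hS : IsBracket S)
    (hg : g ∈ symplecticGroup (Fin p) ℂ) : IsBracket (g * S * gᵀ) := by
  obtain ⟨A, B, hA, hB, rfl⟩ := hS
  refine ⟨g * A * gᵀ, g * B * gᵀ, ?_, ?_, bracket_congr hg A B⟩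
  · simp [transpose_mul, hA, Matrix.mul_assoc]
  · simp [transpose_mul, hB, Matrix.mul_assoc]

/-- Symplectic matrices have symplectic inverses. -/
theorem exists_symplectic_inverse {p : ℕ} {g : Matrix (Idx p) (Idx p) ℂ}
    (hg : g ∈ symplecticGroup (Fin p) ℂ) :
    ∃ h ∈ symplecticGroup (Fin p) ℂ, h * g = 1 ∧ g * h = 1 := by
  refine ⟨((⟨g, hg⟩ : symplecticGroup (Fin p) ℂ)⁻¹ : symplecticGroup (Fin p) ℂ).1,
    ((⟨g, hg⟩ : symplecticGroup (Fin p) ℂ)⁻¹).2, ?_, ?_⟩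
  · exact congrArg Subtype.val (inv_mul_cancel (⟨g, hg⟩ : symplecticGroup (Fin p) ℂ))
  · exact congrArg Subtype.val (mul_inv_cancel (⟨g, hg⟩ : symplecticGroup (Fin p) ℂ))

theorem congr_congr {p : ℕ} {g h : Matrix (Idx p) (Idx p) ℂ} (hgh : h * g = 1)
    (S : Matrix (Idx p) (Idx p) ℂ) : h * (g * S * gᵀ) * hᵀ = S := by
  calc h * (g * S * gᵀ) * hᵀ = (h * g) * S * (h * g)ᵀ := by
        simp only [transpose_mul, Matrix.mul_assoc]
    _ = S := by simp [hgh]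

theorem isBracket_congr_iff {p : ℕ} {S g : Matrix (Idx p) (Idx p) ℂ}
    (hg : g ∈ symplecticGroup (Fin p) ℂ) : IsBracket (g * S * gᵀ) ↔ IsBracket S := by
  refine ⟨fun h => ?_, fun h => h.congr hg⟩
  obtain ⟨k, hk, hkg, -⟩ := exists_symplectic_inverse hg
  simpa only [congr_congr hkg] using h.congr hk

theorem IsBracket.smul {p : ℕ} {S : Matrix (Idx p) (Idx p) ℂ} (hS : IsBracket S) (c : ℂ) :
    IsBracket (c • S) := by
  obtain ⟨A, B, hA, hB, rfl⟩ := hS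
  exact ⟨c • A, B, by simp [hA], hB, by simp [smul_sub]⟩

/-- Brackets are closed under scaling, so membership in the projective image can be tested on any
representative. -/
theorem mem_ran_phi_mk {p : ℕ} (S : SymMat p) (hS : S ≠ 0) :
    Projectivization.mk ℂ S hS ∈ (phi p).ran ↔ IsBracket S.1 := by
  constructor
  · rintro ⟨x, hx⟩
    induction x using Projectivization.ind with
    | h x hx0 =>
      obtain ⟨h, he⟩ := (mem_phi_mk p x hx0 _).1 hx
      obtain ⟨a, ha⟩ := (Projectivization.mk_eq_mk_iff' ℂ _ _ _ _).1 he.symm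
      have hb : IsBracket (phiLift p x).1 := ⟨x.1.1, x.2.1, x.1.2, x.2.2, rfl⟩
      rw [← ha]
      exact hb.smul a
  · rintro ⟨A, B, hA, hB, h⟩
    have he : phiLift p (⟨A, hA⟩, ⟨B, hB⟩) = S := Subtype.ext h
    have hx : ((⟨A, hA⟩, ⟨B, hB⟩) : SkewMat p × SkewMat p) ≠ 0 := by
      intro h0
      apply hS
      rw [← he, h0]
      apply Subtype.ext
      simp [phiLift]
    refine ⟨Projectivization.mk ℂ _ hx, (mem_phi_mk p _ hx _).2 ⟨he ▸ hS, ?_⟩⟩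
    congr 1

theorem mem_dom_phi_mk {p : ℕ} (x : SkewMat p × SkewMat p) (hx : x ≠ 0) :
    Projectivization.mk ℂ x hx ∈ (phi p).Dom ↔ phiLift p x ≠ 0 := by
  rw [PFun.mem_dom]
  constructor
  · rintro ⟨y, hy⟩
    exact ((mem_phi_mk p x hx y).1 hy).1
  · intro h
    exact ⟨_, (mem_phi_mk p x hx _).2 ⟨h, rfl⟩⟩

/-! ### The case n = 2 -/

theorem phiLift_one (x : SkewMat 1 × SkewMat 1) : phiLift 1 x = 0 := by
  have hA : ∀ (A : SkewMat 1) i j, A.1 i j = -A.1 j i := fun A i j =>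
    congrFun (congrFun A.2 j) i
  have h0 : ∀ (A : SkewMat 1) i, A.1 i i = 0 := fun A i => self_eq_neg.1 (hA A i i)
  apply Subtype.ext
  ext i j
  have h1 := hA x.1 (Sum.inr 0) (Sum.inl 0)
  have h2 := hA x.2 (Sum.inr 0) (Sum.inl 0)
  rcases i with i | i <;> rcases j with j | j <;> fin_cases i <;> fin_cases j <;>
    simp [phiLift, stdJ, Matrix.mul_apply, h0, h1, h2, mul_comm]

theorem dom_phi_one : (phi 1).Dom = ∅ := by
  ext x
  induction x using Projectivization.ind with
  | h x hx => simp [mem_dom_phi_mk x hx, phiLift_one]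

/-! ### Transvections and transitivity on nonzero vectors -/

theorem dotProduct_stdJ_mulVec_comm {p : ℕ} (x y : Idx p → ℂ) :
    x ⬝ᵥ stdJ p *ᵥ y = -(y ⬝ᵥ stdJ p *ᵥ x) := by
  rw [dotProduct_mulVec, ← mulVec_transpose, stdJ_transpose, neg_mulVec, neg_dotProduct,
    dotProduct_comm]

theorem stdJ_mulVec_mulVec {p : ℕ} (x : Idx p → ℂ) : stdJ p *ᵥ stdJ p *ᵥ x = -x := by
  rw [mulVec_mulVec, stdJ_mul_stdJ, neg_mulVec, one_mulVec]

theorem stdJ_mulVec_ne_zero {p : ℕ} {x : Idx p → ℂ} (hx : x ≠ 0) : stdJ p *ᵥ x ≠ 0 := by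
  intro h
  have := stdJ_mulVec_mulVec x
  rw [h, mulVec_zero] at this
  exact hx (neg_eq_zero.1 this.symm)

theorem exists_dotProduct_ne_zero {n : Type*} [Fintype n] [DecidableEq n] {x : n → ℂ}
    (hx : x ≠ 0) : ∃ z, z ⬝ᵥ x ≠ 0 := by
  obtain ⟨i, hi⟩ := Function.ne_iff.1 hx
  exact ⟨Pi.single i 1, by simpa using hi⟩

/-- A vector space is not the union of two hyperplanes. -/
theorem exists_dotProduct_ne_zero₂ {n : Type*} [Fintype n] [DecidableEq n] {x y : n → ℂ}
    (hx : x ≠ 0) (hy : y ≠ 0) : ∃ z, z ⬝ᵥ x ≠ 0 ∧ z ⬝ᵥ y ≠ 0 := by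
  obtain ⟨a, ha⟩ := exists_dotProduct_ne_zero hx
  obtain ⟨b, hb⟩ := exists_dotProduct_ne_zero hy
  by_cases h1 : a ⬝ᵥ y = 0
  · by_cases h2 : b ⬝ᵥ x = 0
    · exact ⟨a + b, by simpa [add_dotProduct, h2] using ha,
        by simpa [add_dotProduct, h1] using hb⟩
    · exact ⟨b, h2, hb⟩
  · exact ⟨a, ha, h1⟩

/-- The symplectic transvection `x ↦ x + c ω(w, x) w`. -/
def transvect {p : ℕ} (c : ℂ) (w : Idx p → ℂ) : Matrix (Idx p) (Idx p) ℂ :=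
  1 + c • (vecMulVec w w * stdJ p)

theorem transvect_mem {p : ℕ} (c : ℂ) (w : Idx p → ℂ) :
    transvect c w ∈ symplecticGroup (Fin p) ℂ := by
  have hw : w ⬝ᵥ stdJ p *ᵥ w = 0 := self_eq_neg.1 (dotProduct_stdJ_mulVec_comm w w)
  have hz : vecMulVec w w * (stdJ p * vecMulVec w w) = 0 := by
    rw [mul_vecMulVec, vecMulVec_mul_vecMulVec, hw]; simp
  have hT : (vecMulVec w w)ᵀ = vecMulVec w w := by
    ext i j; simp [vecMulVec_apply, mul_comm]
  rw [mem_symplecticGroup_iff, transvect]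
  simp only [transpose_add, transpose_one, transpose_smul, transpose_mul, stdJ_transpose, hT,
    Matrix.add_mul, Matrix.mul_add, Matrix.one_mul, Matrix.mul_one, smul_mul_assoc,
    mul_smul_comm, Matrix.mul_assoc, stdJ_mul_stdJ, neg_mul, mul_neg, smul_neg, hz]
  rw [← Matrix.mul_assoc (stdJ p) (stdJ p) (vecMulVec w w), stdJ_mul_stdJ]
  simp

theorem transvect_mulVec {p : ℕ} (c : ℂ) (w x : Idx p → ℂ) :
    transvect c w *ᵥ x = x + (c * (w ⬝ᵥ stdJ p *ᵥ x)) • w := by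
  rw [transvect, add_mulVec, one_mulVec, smul_mulVec, ← mulVec_mulVec, vecMulVec_mulVec, mul_smul]
  simp

theorem exists_transvect_mulVec_eq {p : ℕ} {u v : Idx p → ℂ} (h : v ⬝ᵥ stdJ p *ᵥ u ≠ 0) :
    ∃ g ∈ symplecticGroup (Fin p) ℂ, g *ᵥ u = v := by
  have hu : u ⬝ᵥ stdJ p *ᵥ u = 0 := self_eq_neg.1 (dotProduct_stdJ_mulVec_comm u u)
  -- Since ω(v - u, u) = ω(v, u), this coefficient makes the transvection add exactly v - u to u.
  refine ⟨transvect (v ⬝ᵥ stdJ p *ᵥ u)⁻¹ (v - u), transvect_mem _ _, ?_⟩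
  rw [transvect_mulVec, sub_dotProduct, hu, sub_zero, inv_mul_cancel₀ h]
  simp

/-- The symplectic group acts transitively on nonzero vectors. -/
theorem exists_symplectic_mulVec_eq {p : ℕ} {u v : Idx p → ℂ} (hu : u ≠ 0) (hv : v ≠ 0) :
    ∃ g ∈ symplecticGroup (Fin p) ℂ, g *ᵥ u = v := by
  -- A vector z pairing nontrivially with both u and v lets two transvections do the work: u ↦ z ↦
  -- v.
  obtain ⟨z, h1, h2⟩ := exists_dotProduct_ne_zero₂ (stdJ_mulVec_ne_zero hu)
    (stdJ_mulVec_ne_zero hv)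
  obtain ⟨g, hg, hgu⟩ := exists_transvect_mulVec_eq h1
  have h3 : v ⬝ᵥ stdJ p *ᵥ z ≠ 0 := by
    rw [dotProduct_stdJ_mulVec_comm]; exact neg_ne_zero.2 h2
  obtain ⟨k, hk, hkz⟩ := exists_transvect_mulVec_eq h3
  exact ⟨k * g, mul_mem hk hg, by rw [← mulVec_mulVec, hgu, hkz]⟩

/-! ### Splitting off a hyperbolic plane -/

/-- The inclusion of index sets that skips the first index of each block. -/
abbrev idxSucc {p : ℕ} : Idx p → Idx (p + 1) := Sum.map Fin.succ Fin.succ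

/-- The block sum of the identity on the first hyperbolic plane and `g` on the others. -/
def extendOne {p : ℕ} (g : Matrix (Idx p) (Idx p) ℂ) : Matrix (Idx (p + 1)) (Idx (p + 1)) ℂ :=
  Matrix.of fun i j => match i, j with
  | .inl i, .inl j =>
    Fin.cases (Fin.cases 1 (fun _ => 0) j)
      (fun i => Fin.cases 0 (fun j => g (.inl i) (.inl j)) j) i
  | .inl i, .inr j => Fin.cases 0 (fun i => Fin.cases 0 (fun j => g (.inl i) (.inr j)) j) i
  | .inr i, .inl j => Fin.cases 0 (fun i => Fin.cases 0 (fun j => g (.inr i) (.inl j)) j) i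
  | .inr i, .inr j =>
    Fin.cases (Fin.cases 1 (fun _ => 0) j)
      (fun i => Fin.cases 0 (fun j => g (.inr i) (.inr j)) j) i

section
variable {p : ℕ} (g : Matrix (Idx p) (Idx p) ℂ)

theorem sum_extendOne_inl_zero (f : Idx (p + 1) → ℂ) :
    ∑ k, extendOne g (.inl 0) k * f k = f (.inl 0) := by
  simp [extendOne, Fin.sum_univ_succ]

theorem sum_extendOne_inr_zero (f : Idx (p + 1) → ℂ) :
    ∑ k, extendOne g (.inr 0) k * f k = f (.inr 0) := by
  simp [extendOne, Fin.sum_univ_succ]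

theorem sum_extendOne_idxSucc (f : Idx (p + 1) → ℂ) (i : Idx p) :
    ∑ k, extendOne g (idxSucc i) k * f k = ∑ k, g i k * f (idxSucc k) := by
  rcases i with i | i <;> simp [extendOne, Fin.sum_univ_succ]

theorem mul_mul_transpose_apply {n : Type*} [Fintype n] (g A : Matrix n n ℂ) (i j : n) :
    (g * A * gᵀ) i j = ∑ k, g i k * ∑ l, g j l * A k l := by
  simp only [Matrix.mul_apply, transpose_apply, Finset.sum_mul, Finset.mul_sum]
  rw [Finset.sum_comm]
  exact Finset.sum_congr rfl fun _ _ => Finset.sum_congr rfl fun _ _ => by ring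

theorem extendOne_congr_idxSucc (A : Matrix (Idx (p + 1)) (Idx (p + 1)) ℂ) (i j : Idx p) :
    (extendOne g * A * (extendOne g)ᵀ) (idxSucc i) (idxSucc j) =
      (g * A.submatrix idxSucc idxSucc * gᵀ) i j := by
  simp only [mul_mul_transpose_apply, sum_extendOne_idxSucc, submatrix_apply]

theorem idx_succ_cases {P : Idx (p + 1) → Prop} (h1 : P (.inl 0)) (h2 : P (.inr 0))
    (h3 : ∀ i : Idx p, P (idxSucc i)) (i : Idx (p + 1)) : P i := by
  rcases i with i | i
  · refine Fin.cases h1 (fun i => h3 (.inl i)) i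
  · refine Fin.cases h2 (fun i => h3 (.inr i)) i

theorem stdJ_submatrix : (stdJ (p + 1)).submatrix idxSucc idxSucc = stdJ p := by
  ext i j
  rcases i with i | i <;> rcases j with j | j <;> simp [stdJ, Matrix.one_apply]

theorem extendOne_mem (hg : g ∈ symplecticGroup (Fin p) ℂ) :
    extendOne g ∈ symplecticGroup (Fin (p + 1)) ℂ := by
  rw [mem_symplecticGroup_iff] at hg ⊢
  ext i j
  induction i using idx_succ_cases with
  | h3 i =>
    induction j using idx_succ_cases with
    | h3 j => rw [extendOne_congr_idxSucc, stdJ_submatrix, hg, ← stdJ_submatrix]; rfl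
    | h1 =>
      simp only [mul_mul_transpose_apply, sum_extendOne_inl_zero, sum_extendOne_idxSucc]
      rcases i with i | i <;> simp [stdJ]
    | h2 =>
      simp only [mul_mul_transpose_apply, sum_extendOne_inr_zero, sum_extendOne_idxSucc]
      rcases i with i | i <;> simp [stdJ]
  | h1 =>
    induction j using idx_succ_cases with
    | h3 j =>
      simp only [mul_mul_transpose_apply, sum_extendOne_inl_zero, sum_extendOne_idxSucc]
      rcases j with i | i <;> simp [stdJ, (Fin.succ_ne_zero _).symm]
    | h1 => simp only [mul_mul_transpose_apply, sum_extendOne_inl_zero]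
    | h2 => simp only [mul_mul_transpose_apply, sum_extendOne_inl_zero, sum_extendOne_inr_zero]
  | h2 =>
    induction j using idx_succ_cases with
    | h3 j =>
      simp only [mul_mul_transpose_apply, sum_extendOne_inr_zero, sum_extendOne_idxSucc]
      rcases j with i | i <;> simp [stdJ, (Fin.succ_ne_zero _).symm]
    | h1 => simp only [mul_mul_transpose_apply, sum_extendOne_inl_zero, sum_extendOne_inr_zero]
    | h2 => simp only [mul_mul_transpose_apply, sum_extendOne_inr_zero]

end

/-! ### Triangular forms of symmetric (ε = 1) and skew (ε = -1) matrices -/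

/-- `A` is congruent under the symplectic group to a matrix with lower right block `0` and upper
right block upper triangular with diagonal `μ`. -/
def IsTri {p : ℕ} (ε : ℂ) (A : Matrix (Idx p) (Idx p) ℂ) (μ : Fin p → ℂ) : Prop :=
  ∃ g ∈ symplecticGroup (Fin p) ℂ, ∃ N M : Matrix (Fin p) (Fin p) ℂ,
    Nᵀ = ε • N ∧ M.BlockTriangular id ∧ (∀ i, M i i = μ i) ∧
      g * A * gᵀ = fromBlocks N M (ε • Mᵀ) 0

theorem congr_transpose {n : Type*} [Fintype n] {ε : ℂ} {A : Matrix n n ℂ} (hA : Aᵀ = ε • A)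
    (g : Matrix n n ℂ) : (g * A * gᵀ)ᵀ = ε • (g * A * gᵀ) := by
  simp [transpose_mul, hA, Matrix.mul_assoc]

theorem IsTri.of_congr {p : ℕ} {ε : ℂ} {A g : Matrix (Idx p) (Idx p) ℂ} {μ : Fin p → ℂ}
    (hg : g ∈ symplecticGroup (Fin p) ℂ) (h : IsTri ε (g * A * gᵀ) μ) : IsTri ε A μ := by
  obtain ⟨k, hk, N, M, hN, hM, hμ, he⟩ := h
  refine ⟨k * g, mul_mem hk hg, N, M, hN, hM, hμ, ?_⟩
  rw [← he, transpose_mul]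
  simp only [Matrix.mul_assoc]

/-- Induction step of triangularization. As J sends the vector at `.inr 0` to the one at `.inl 0`,
`ht` makes column `.inr 0` of A equal to t times that vector; ε-symmetry fixes the corresponding
row, and `extendOne g` leaves this column unchanged while treating the smaller block. -/
theorem IsTri.extend {p : ℕ} {ε t : ℂ} {A : Matrix (Idx (p + 1)) (Idx (p + 1)) ℂ}
    (hA : Aᵀ = ε • A)
    (ht : A *ᵥ Pi.single (.inr 0) 1 = t • stdJ (p + 1) *ᵥ Pi.single (.inr 0) 1)
    {μ : Fin p → ℂ} (h : IsTri ε (A.submatrix idxSucc idxSucc) μ) :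
    IsTri ε A (Fin.cons t μ) := by
  obtain ⟨g, hg, N, M, hN, hM, hμ, he⟩ := h
  set B := extendOne g * A * (extendOne g)ᵀ with hB
  have hBT : Bᵀ = ε • B := congr_transpose hA _
  have hsymm : ∀ i j, B j i = ε * B i j := fun i j => congrFun (congrFun hBT i) j
  have hcol : ∀ k, A k (.inr 0) = t * stdJ (p + 1) k (.inr 0) := by
    intro k
    have := congrFun ht k
    simpa using this
  have hB0 : ∀ i, B i (.inr 0) = if i = .inl 0 then t else 0 := by
    intro i
    rw [hB, mul_mul_transpose_apply]
    simp only [sum_extendOne_inr_zero, hcol]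
    induction i using idx_succ_cases with
    | h1 => rw [sum_extendOne_inl_zero]; simp [stdJ]
    | h2 => rw [sum_extendOne_inr_zero]; simp [stdJ]
    | h3 i =>
      rw [sum_extendOne_idxSucc]
      rcases i with i | i <;> simp [stdJ]
  have hBs : ∀ i j, B (idxSucc i) (idxSucc j) = fromBlocks N M (ε • Mᵀ) 0 i j := by
    intro i j
    rw [hB, extendOne_congr_idxSucc, he]
  refine ⟨extendOne g, extendOne_mem g hg, B.toBlocks₁₁, B.toBlocks₁₂, ?_, ?_, ?_, ?_⟩
  · ext i j; exact hsymm _ _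
  · intro i j hij
    induction j using Fin.cases with
    | zero =>
      have : i ≠ 0 := (ne_of_gt hij)
      simp [toBlocks₁₂, hB0, this]
    | succ j =>
      induction i using Fin.cases with
      | zero => exact absurd hij (by simp)
      | succ i => exact (hBs (.inl i) (.inr j)).trans (hM (by simpa using hij))
  · intro i
    induction i using Fin.cases with
    | zero => simp [toBlocks₁₂, hB0]
    | succ i => exact (hBs (.inl i) (.inr i)).trans (hμ i)
  · rw [← hB]
    ext i j
    rcases i with i | i <;> rcases j with j | j
    · rfl
    · rfl
    · exact hsymm _ _
    · change B (.inr i) (.inr j) = 0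
      induction j using Fin.cases with
      | zero => simp [hB0]
      | succ j =>
        induction i using Fin.cases with
        | zero => rw [hsymm, hB0]; simp
        | succ i => exact hBs (.inr i) (.inr j)

/-- Congruence carries the kernel of A - tJ along, so transitivity moves a kernel vector to a chosen
coordinate vector. -/
theorem exists_congr_mulVec_single {p : ℕ} {A : Matrix (Idx (p + 1)) (Idx (p + 1)) ℂ} {t : ℂ}
    {v : Idx (p + 1) → ℂ} (hv : v ≠ 0) (h : A *ᵥ v = t • stdJ (p + 1) *ᵥ v) :
    ∃ g ∈ symplecticGroup (Fin (p + 1)) ℂ,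
      (g * A * gᵀ) *ᵥ Pi.single (.inr 0) 1 = t • stdJ (p + 1) *ᵥ Pi.single (.inr 0) 1 := by
  have hf : (Pi.single (.inr 0) 1 : Idx (p + 1) → ℂ) ≠ 0 := by
    intro h0
    simpa using congrFun h0 (.inr 0)
  obtain ⟨k, hk, hkv⟩ := exists_symplectic_mulVec_eq hf hv
  refine ⟨kᵀ, SymplecticGroup.transpose_mem hk, ?_⟩
  rw [transpose_transpose, ← mulVec_mulVec, ← mulVec_mulVec, hkv, h, mulVec_smul, ← hkv,
    mulVec_mulVec, mulVec_mulVec, transpose_mul_stdJ_mul hk]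

theorem submatrix_transpose_eq {p : ℕ} {ε : ℂ} {A : Matrix (Idx (p + 1)) (Idx (p + 1)) ℂ}
    (hA : Aᵀ = ε • A) : (A.submatrix (idxSucc (p := p)) idxSucc)ᵀ =
      ε • A.submatrix idxSucc idxSucc := by
  rw [transpose_submatrix, hA]; rfl

theorem exists_isTri {p : ℕ} {ε : ℂ} (A : Matrix (Idx p) (Idx p) ℂ)
    (hA : Aᵀ = ε • A) : ∃ μ, IsTri ε A μ := by
  induction p with
  | zero =>
    refine ⟨0, 1, one_mem _, 0, 0, by simp, fun i => i.elim0, fun i => i.elim0, ?_⟩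
    ext i
    rcases i with i | i <;> exact i.elim0
  | succ p ih =>
    -- If AJu = su, then Ju lies in the kernel of A - tJ for t = -s.
    obtain ⟨s, hs⟩ := Module.End.exists_eigenvalue (Matrix.toLin' (A * stdJ (p + 1)))
    obtain ⟨u, hu⟩ := hs.exists_hasEigenvector
    have h1 : A *ᵥ (stdJ (p + 1) *ᵥ u) = (-s) • stdJ (p + 1) *ᵥ (stdJ (p + 1) *ᵥ u) := by
      rw [stdJ_mulVec_mulVec, mulVec_mulVec, ← Matrix.toLin'_apply, hu.apply_eq_smul]
      simp
    obtain ⟨g, hg, hgA⟩ := exists_congr_mulVec_single (stdJ_mulVec_ne_zero hu.2) h1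
    obtain ⟨μ, hμ⟩ := ih _ (submatrix_transpose_eq (congr_transpose hA g))
    exact ⟨_, (hμ.extend (congr_transpose hA g) hgA).of_congr hg⟩

/-! ### The pencil det(A - tJ) -/

open Polynomial in
/-- The polynomial `det (A - tJ)` in `t`. -/
def pencil {p : ℕ} (A : Matrix (Idx p) (Idx p) ℂ) : ℂ[X] :=
  (A.map C - (X : ℂ[X]) • (stdJ p).map C).det

theorem stdJ_mem (p : ℕ) : stdJ p ∈ symplecticGroup (Fin p) ℂ := by
  rw [stdJ_eq_neg_J]
  exact SymplecticGroup.neg_mem (SymplecticGroup.J_mem _ _)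

theorem pencil_congr {p : ℕ} {g : Matrix (Idx p) (Idx p) ℂ}
    (hg : g ∈ symplecticGroup (Fin p) ℂ) (A : Matrix (Idx p) (Idx p) ℂ) :
    pencil (g * A * gᵀ) = pencil A := by
  have hdet : (g.map (Polynomial.C : ℂ →+* _)).det = 1 := by
    have := RingHom.map_det (Polynomial.C : ℂ →+* _) g
    rw [SymplecticGroup.det_eq_one hg, map_one] at this
    exact this.symm
  have key : (g * A * gᵀ).map Polynomial.C -
      (Polynomial.X : Polynomial ℂ) • (stdJ p).map Polynomial.C =
      g.map Polynomial.C * (A.map Polynomial.C -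
        (Polynomial.X : Polynomial ℂ) • (stdJ p).map Polynomial.C) * (g.map Polynomial.C)ᵀ := by
    conv_lhs => rw [← mem_symplecticGroup_iff.1 hg]
    simp only [Matrix.map_mul, Matrix.mul_sub, Matrix.sub_mul, transpose_map, mul_smul_comm,
      smul_mul_assoc]
  rw [pencil, key, det_mul, det_mul, det_transpose, hdet, one_mul, mul_one, pencil]

open Polynomial in
-- Right multiplication by J, of determinant 1, makes the pencil block upper triangular with
-- diagonal blocks X - M and X + εMᵀ.
theorem pencil_fromBlocks {p : ℕ} (ε : ℂ) (N M : Matrix (Fin p) (Fin p) ℂ)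
    (hM : M.BlockTriangular id) :
    pencil (fromBlocks N M (ε • Mᵀ) 0) = ∏ i, (X - C (M i i)) * (X + C (ε * M i i)) := by
  have hdet : ((stdJ p).map (C : ℂ →+* _)).det = 1 := by
    have := RingHom.map_det (C : ℂ →+* _) (stdJ p)
    rw [SymplecticGroup.det_eq_one (stdJ_mem p), map_one] at this
    exact this.symm
  rw [pencil, ← mul_one (det _), ← hdet, ← det_mul]
  have hJ : (stdJ p).map C = fromBlocks 0 1 (-1) (0 : Matrix (Fin p) (Fin p) ℂ[X]) := by
    simp [stdJ, fromBlocks_map, Matrix.map_neg]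
  have e1 : ((fromBlocks N M (ε • Mᵀ) 0).map C - (X : ℂ[X]) • (stdJ p).map C) * (stdJ p).map C
      = fromBlocks (scalar (Fin p) (X : ℂ[X]) - M.map C) (N.map C) 0
        (scalar (Fin p) X + C ε • (M.map C)ᵀ) := by
    rw [hJ, fromBlocks_map, fromBlocks_smul, sub_eq_add_neg, fromBlocks_neg, fromBlocks_add,
      fromBlocks_multiply]
    congr 1
    · ext1 i j; simp [Matrix.one_apply, Matrix.diagonal_apply]; split_ifs <;> ring
    · simp
    · simp [Matrix.map_zero]
    · ext1 i j; simp [Matrix.one_apply, Matrix.diagonal_apply]; split_ifs <;> ring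
  rw [e1, det_fromBlocks_zero₂₁, Finset.prod_mul_distrib, det_of_isUpperTriangular,
    ← det_transpose (_ + _), det_of_isUpperTriangular]
  · simp
  · intro i j hij
    have hne : j ≠ i := ne_of_lt hij
    simp [hM hij, hne]
  · intro i j hij
    have hne : i ≠ j := ne_of_gt hij
    simp [hM hij, hne]

open Polynomial in
theorem IsTri.pencil_eq {p : ℕ} {ε : ℂ} {A : Matrix (Idx p) (Idx p) ℂ} {μ : Fin p → ℂ}
    (h : IsTri ε A μ) : pencil A = ∏ i, (X - C (μ i)) * (X + C (ε * μ i)) := by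
  obtain ⟨g, hg, N, M, hN, hM, hμ, he⟩ := h
  rw [← pencil_congr hg, he, pencil_fromBlocks _ _ _ hM]
  simp only [hμ]

theorem eval_pencil {p : ℕ} (A : Matrix (Idx p) (Idx p) ℂ) (t : ℂ) :
    (pencil A).eval t = (A - t • stdJ p).det := by
  rw [pencil, ← Polynomial.coe_evalRingHom, RingHom.map_det]
  congr 1
  ext i j
  simp
  exact mul_comm _ _

open Polynomial in
/-- The diagonal of a triangular form can be prescribed by the pencil. -/
theorem isTri_of_pencil_eq {p : ℕ} {ε : ℂ} (A : Matrix (Idx p) (Idx p) ℂ)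
    (hA : Aᵀ = ε • A) (μ : Fin p → ℂ)
    (h : pencil A = ∏ i, (X - C (μ i)) * (X + C (ε * μ i))) : IsTri ε A μ := by
  induction p with
  | zero =>
    refine ⟨1, one_mem _, 0, 0, by simp, fun i => i.elim0, fun i => i.elim0, ?_⟩
    ext i
    rcases i with i | i <;> exact i.elim0
  | succ p ih =>
    -- The root μ 0 of the pencil supplies a kernel vector, hence a first diagonal entry equal to μ
    -- 0.
    have hroot : (A - μ 0 • stdJ (p + 1)).det = 0 := by
      rw [← eval_pencil, h, Fin.prod_univ_succ]
      simp
    obtain ⟨v, hv, hAv⟩ := Matrix.exists_mulVec_eq_zero_iff.2 hroot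
    rw [sub_mulVec, sub_eq_zero, smul_mulVec] at hAv
    obtain ⟨g, hg, hgA⟩ := exists_congr_mulVec_single hv hAv
    have hAg := congr_transpose hA g
    -- The diagonal ν is auxiliary: it serves to compute the pencil of the smaller block, where the
    -- factor belonging to μ 0 cancels.
    obtain ⟨ν, hν⟩ := exists_isTri _ (submatrix_transpose_eq hAg)
    have h2 := (hν.extend hAg hgA).pencil_eq
    rw [pencil_congr hg, h, Fin.prod_univ_succ, Fin.prod_univ_succ] at h2
    simp only [Fin.cons_zero, Fin.cons_succ] at h2
    have hne : (X - C (μ 0)) * (X + C (ε * μ 0)) ≠ 0 :=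
      mul_ne_zero (X_sub_C_ne_zero _) (X_add_C_ne_zero _)
    have h3 := mul_left_cancel₀ hne h2
    have h4 := ih _ (submatrix_transpose_eq hAg) (fun i => μ i.succ) (by rw [hν.pencil_eq, h3])
    have h5 := (h4.extend hAg hgA).of_congr hg
    convert h5 using 1
    exact (Fin.cons_self_tail μ).symm

/-! ### Levi and Siegel elements: conjugating M, and shifting N by Mh + εhMᵀ -/

theorem levi_mem {p : ℕ} {u w : Matrix (Fin p) (Fin p) ℂ} (h : u * w = 1) :
    fromBlocks u 0 0 wᵀ ∈ symplecticGroup (Fin p) ℂ := by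
  rw [mem_symplecticGroup_iff, stdJ, fromBlocks_transpose, fromBlocks_multiply,
    fromBlocks_multiply]
  have h2 : wᵀ * uᵀ = 1 := by rw [← transpose_mul, h, transpose_one]
  simp [h, h2]

theorem levi_congr {p : ℕ} (ε : ℂ) (u w N M : Matrix (Fin p) (Fin p) ℂ) :
    fromBlocks u 0 0 wᵀ * fromBlocks N M (ε • Mᵀ) 0 * (fromBlocks u 0 0 wᵀ)ᵀ =
      fromBlocks (u * N * uᵀ) (u * M * w) (ε • (u * M * w)ᵀ) 0 := by
  rw [fromBlocks_transpose, fromBlocks_multiply, fromBlocks_multiply]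
  simp [transpose_mul, Matrix.mul_assoc]

theorem siegel_mem {p : ℕ} {h : Matrix (Fin p) (Fin p) ℂ} (hh : hᵀ = h) :
    fromBlocks 1 h 0 1 ∈ symplecticGroup (Fin p) ℂ := by
  rw [mem_symplecticGroup_iff, stdJ, fromBlocks_transpose, fromBlocks_multiply,
    fromBlocks_multiply]
  simp [hh]

theorem siegel_congr {p : ℕ} (ε : ℂ) {h : Matrix (Fin p) (Fin p) ℂ} (hh : hᵀ = h)
    (N M : Matrix (Fin p) (Fin p) ℂ) :
    fromBlocks 1 h 0 1 * fromBlocks N M (ε • Mᵀ) 0 * (fromBlocks 1 h 0 1)ᵀ =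
      fromBlocks (N + ε • (h * Mᵀ) + M * h) M (ε • Mᵀ) 0 := by
  rw [fromBlocks_transpose, fromBlocks_multiply, fromBlocks_multiply]
  simp [hh]

/-! ### n = 6: the quartic invariant and its vanishing on brackets -/

theorem trace_fromBlocks {p : ℕ} (A B C D : Matrix (Fin p) (Fin p) ℂ) :
    (fromBlocks A B C D).trace = A.trace + D.trace := by
  simp [Matrix.trace]

/-- The quartic invariant `tr Z⁴ - (tr Z²)² / 4` of `Z = SJ`. -/
def quartic {p : ℕ} (S : Matrix (Idx p) (Idx p) ℂ) : ℂ :=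
  ((S * stdJ p) ^ 4).trace - 4⁻¹ * ((S * stdJ p) ^ 2).trace ^ 2

/-- From gᵀJg = J one gets (gSgᵀ)J = g(SJ)g⁻¹, so congruence of S is conjugation of SJ. -/
theorem trace_congr_pow {p : ℕ} {g : Matrix (Idx p) (Idx p) ℂ}
    (hg : g ∈ symplecticGroup (Fin p) ℂ) (S : Matrix (Idx p) (Idx p) ℂ) (k : ℕ) :
    ((g * S * gᵀ * stdJ p) ^ k).trace = ((S * stdJ p) ^ k).trace := by
  obtain ⟨h, hh, h1, h2⟩ := exists_symplectic_inverse hg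
  have key : g * S * gᵀ * stdJ p = g * (S * stdJ p) * h := by
    calc g * S * gᵀ * stdJ p = g * S * (gᵀ * stdJ p * g) * h := by
          simp only [Matrix.mul_assoc, h2, Matrix.mul_one]
      _ = _ := by rw [transpose_mul_stdJ_mul hg]; simp only [Matrix.mul_assoc]
  have hpow : (g * (S * stdJ p) * h) ^ k = g * (S * stdJ p) ^ k * h := by
    induction k with
    | zero => simp [h2]
    | succ k ih =>
      rw [pow_succ, ih, pow_succ]
      calc g * (S * stdJ p) ^ k * h * (g * (S * stdJ p) * h)
          = g * (S * stdJ p) ^ k * (h * g) * (S * stdJ p) * h := by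
            simp only [Matrix.mul_assoc]
        _ = _ := by rw [h1]; simp only [Matrix.mul_assoc, Matrix.one_mul]
  rw [key, hpow, trace_mul_comm, ← Matrix.mul_assoc, h1, Matrix.one_mul]

theorem quartic_congr {p : ℕ} {g : Matrix (Idx p) (Idx p) ℂ}
    (hg : g ∈ symplecticGroup (Fin p) ℂ) (S : Matrix (Idx p) (Idx p) ℂ) :
    quartic (g * S * gᵀ) = quartic S := by
  rw [quartic, quartic, trace_congr_pow hg, trace_congr_pow hg]

theorem exists_eq_of_upperTriangular {M : Matrix (Fin 3) (Fin 3) ℂ} (hM : M.BlockTriangular id) :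
    ∃ m₁ m₂ m₃ m₁₂ m₁₃ m₂₃ : ℂ, M = !![m₁, m₁₂, m₁₃; 0, m₂, m₂₃; 0, 0, m₃] := by
  have h10 : M 1 0 = 0 := hM (by decide)
  have h20 : M 2 0 = 0 := hM (by decide)
  have h21 : M 2 1 = 0 := hM (by decide)
  refine ⟨M 0 0, M 1 1, M 2 2, M 0 1, M 0 2, M 1 2, ?_⟩
  conv_lhs => rw [eta_fin_three M, h10, h20, h21]

theorem trace_pow_upperTriangular {M : Matrix (Fin 3) (Fin 3) ℂ} (hM : M.BlockTriangular id) :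
    (M * M).trace = ∑ i, M i i ^ 2 ∧ (M * M * (M * M)).trace = ∑ i, M i i ^ 4 := by
  have h10 : M 1 0 = 0 := hM (by decide)
  have h20 : M 2 0 = 0 := hM (by decide)
  have h21 : M 2 1 = 0 := hM (by decide)
  constructor <;>
    simp only [Matrix.trace_fin_three, Matrix.mul_apply, Fin.sum_univ_three, h10, h20, h21] <;>
    ring

theorem quartic_fromBlocks {N M : Matrix (Fin 3) (Fin 3) ℂ} (hM : M.BlockTriangular id) :
    quartic (fromBlocks N M Mᵀ 0) = 2 * (∑ i, M i i ^ 4) - (∑ i, M i i ^ 2) ^ 2 := by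
  have h1 : fromBlocks N M Mᵀ 0 * stdJ 3 = fromBlocks (-M) N 0 Mᵀ := by
    rw [stdJ, fromBlocks_multiply]; simp
  have h2 : (fromBlocks (-M) N 0 Mᵀ) ^ 2 = fromBlocks (M * M) (-(M * N) + N * Mᵀ) 0 (M * M)ᵀ := by
    rw [pow_two, fromBlocks_multiply]; simp [transpose_mul]
  rw [quartic, h1, show 4 = 2 * 2 from rfl, pow_mul, h2, pow_two, fromBlocks_multiply,
    trace_fromBlocks, trace_fromBlocks]
  simp only [Matrix.mul_zero, add_zero, zero_add, Matrix.zero_mul, ← transpose_mul,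
    trace_transpose, (trace_pow_upperTriangular hM).1, (trace_pow_upperTriangular hM).2]
  ring

open Polynomial in
theorem coeff_heron_product (a b c : ℂ) :
    ((X - C a) * (X + C a) * ((X - C b) * (X + C b)) * ((X - C c) * (X + C c))).coeff 4 =
        -(a ^ 2 + b ^ 2 + c ^ 2) ∧
      ((X - C a) * (X + C a) * ((X - C b) * (X + C b)) * ((X - C c) * (X + C c))).coeff 2 =
        a ^ 2 * b ^ 2 + a ^ 2 * c ^ 2 + b ^ 2 * c ^ 2 := by
  have h : (X - C a) * (X + C a) * ((X - C b) * (X + C b)) * ((X - C c) * (X + C c)) =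
      X ^ 6 - C (a ^ 2 + b ^ 2 + c ^ 2) * X ^ 4 +
        C (a ^ 2 * b ^ 2 + a ^ 2 * c ^ 2 + b ^ 2 * c ^ 2) * X ^ 2 - C (a ^ 2 * b ^ 2 * c ^ 2) := by
    simp only [map_add, map_mul, map_pow]
    ring
  rw [h]
  generalize a ^ 2 + b ^ 2 + c ^ 2 = e₁
  generalize a ^ 2 * b ^ 2 + a ^ 2 * c ^ 2 + b ^ 2 * c ^ 2 = e₂
  generalize a ^ 2 * b ^ 2 * c ^ 2 = e₃
  constructor <;> simp only [coeff_sub, coeff_add, coeff_C_mul, coeff_X_pow, coeff_C] <;> simp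

/-- Both sides are (Σμᵢ²)² - 4Σμᵢ²μⱼ² for the spectrum ±μᵢ of SJ. The trace expression replaces a 6
× 6 characteristic polynomial in all later computations. -/
theorem quartic_eq_pencil {S : Matrix (Idx 3) (Idx 3) ℂ} (hS : Sᵀ = S) :
    (pencil S).coeff 4 ^ 2 - 4 * (pencil S).coeff 2 = quartic S := by
  obtain ⟨μ, hμ⟩ := exists_isTri (ε := 1) S (by simpa using hS)
  have hp := hμ.pencil_eq
  obtain ⟨g, hg, N, M, hN, hM, hd, he⟩ := hμ
  rw [one_smul] at he
  rw [← quartic_congr hg, he, quartic_fromBlocks hM, hp]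
  simp only [one_mul, Fin.prod_univ_three, Fin.sum_univ_three, hd, coeff_heron_product]
  ring

/-- Grouped by hyperbolic planes, Z = SJ is a 3 × 3 array of 2 × 2 blocks with zero diagonal and Zⱼᵢ
= -adj Zᵢⱼ; hence tr Z⁴ and (tr Z²)²/4 both equal 4(Σ det Zᵢⱼ)², summed over i < j. The proof checks
this by expansion in the twelve remaining entries. -/
theorem quartic_of_diag_eq_zero {S : Matrix (Idx 3) (Idx 3) ℂ} (hS : Sᵀ = S)
    (h11 : ∀ i, S (.inl i) (.inl i) = 0) (h12 : ∀ i, S (.inl i) (.inr i) = 0)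
    (h22 : ∀ i, S (.inr i) (.inr i) = 0) : quartic S = 0 := by
  have hs : ∀ i j, S i j = S j i := fun i j => congrFun (congrFun hS j) i
  have e : S = fromBlocks
      !![0, S (.inl 0) (.inl 1), S (.inl 0) (.inl 2);
        S (.inl 0) (.inl 1), 0, S (.inl 1) (.inl 2);
        S (.inl 0) (.inl 2), S (.inl 1) (.inl 2), 0]
      !![0, S (.inl 0) (.inr 1), S (.inl 0) (.inr 2);
        S (.inl 1) (.inr 0), 0, S (.inl 1) (.inr 2);
        S (.inl 2) (.inr 0), S (.inl 2) (.inr 1), 0]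
      !![0, S (.inl 1) (.inr 0), S (.inl 2) (.inr 0);
        S (.inl 0) (.inr 1), 0, S (.inl 2) (.inr 1);
        S (.inl 0) (.inr 2), S (.inl 1) (.inr 2), 0]
      !![0, S (.inr 0) (.inr 1), S (.inr 0) (.inr 2);
        S (.inr 0) (.inr 1), 0, S (.inr 1) (.inr 2);
        S (.inr 0) (.inr 2), S (.inr 1) (.inr 2), 0] := by
    ext i j
    rcases i with i | i <;> rcases j with j | j <;> fin_cases i <;> fin_cases j <;>
      simp [h11, h12, h22] <;> first | exact hs _ _ | exact (hs _ _).trans (h12 _)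
  generalize S (.inl 0) (.inl 1) = a1 at e
  generalize S (.inl 0) (.inl 2) = a2 at e
  generalize S (.inl 1) (.inl 2) = a3 at e
  generalize S (.inr 0) (.inr 1) = b1 at e
  generalize S (.inr 0) (.inr 2) = b2 at e
  generalize S (.inr 1) (.inr 2) = b3 at e
  generalize S (.inl 0) (.inr 1) = c1 at e
  generalize S (.inl 0) (.inr 2) = c2 at e
  generalize S (.inl 1) (.inr 0) = c3 at e
  generalize S (.inl 1) (.inr 2) = c4 at e
  generalize S (.inl 2) (.inr 0) = c5 at e
  generalize S (.inl 2) (.inr 1) = c6 at e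
  subst e
  rw [quartic, stdJ, fromBlocks_multiply, show 4 = 2 * 2 from rfl, pow_mul, pow_two, pow_two,
    fromBlocks_multiply, fromBlocks_multiply, trace_fromBlocks, trace_fromBlocks]
  simp only [Matrix.mul_zero, Matrix.mul_one, Matrix.mul_neg, zero_add, add_zero]
  simp [Matrix.trace_fin_three]
  ring

/-- The block matrix `[0, D; -D, 0]` with `D` diagonal. -/
def skewDiag {p : ℕ} (d : Fin p → ℂ) : Matrix (Idx p) (Idx p) ℂ :=
  fromBlocks 0 (diagonal d) (-diagonal d) 0

theorem skewDiag_mul_stdJ {p : ℕ} (d : Fin p → ℂ) :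
    skewDiag d * stdJ p = -diagonal (Sum.elim d d) := by
  rw [skewDiag, stdJ, fromBlocks_multiply, ← fromBlocks_diagonal, fromBlocks_neg]; simp

theorem stdJ_mul_skewDiag {p : ℕ} (d : Fin p → ℂ) :
    stdJ p * skewDiag d = -diagonal (Sum.elim d d) := by
  rw [skewDiag, stdJ, fromBlocks_multiply, ← fromBlocks_diagonal, fromBlocks_neg]; simp

/-- Multiplying `skewDiag d` by J gives a diagonal matrix, so the bracket scales entries by
differences of the d's and kills those inside one hyperbolic plane. -/
theorem bracket_skewDiag_apply {p : ℕ} (d : Fin p → ℂ) (B : Matrix (Idx p) (Idx p) ℂ)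
    (i j : Idx p) : (skewDiag d * stdJ p * B - B * stdJ p * skewDiag d) i j =
      (Sum.elim d d j - Sum.elim d d i) * B i j := by
  rw [skewDiag_mul_stdJ, Matrix.mul_assoc B, stdJ_mul_skewDiag]
  simp only [neg_mul, mul_neg, sub_neg_eq_add, Matrix.add_apply, Matrix.neg_apply, diagonal_mul, mul_diagonal]
  ring

theorem bracket_transpose {p : ℕ} {A B : Matrix (Idx p) (Idx p) ℂ} (hA : Aᵀ = -A)
    (hB : Bᵀ = -B) : (A * stdJ p * B - B * stdJ p * A)ᵀ = A * stdJ p * B - B * stdJ p * A :=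
  bracket_mem p ⟨A, hA⟩ ⟨B, hB⟩

theorem skewDiag_transpose {p : ℕ} (d : Fin p → ℂ) : (skewDiag d)ᵀ = -skewDiag d := by
  simp [skewDiag, fromBlocks_transpose, fromBlocks_neg]

theorem quartic_bracket_skewDiag (d : Fin 3 → ℂ) {B : Matrix (Idx 3) (Idx 3) ℂ}
    (hB : Bᵀ = -B) : quartic (skewDiag d * stdJ 3 * B - B * stdJ 3 * skewDiag d) = 0 := by
  refine quartic_of_diag_eq_zero (bracket_transpose (skewDiag_transpose d) hB) ?_ ?_ ?_ <;>
  · intro i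
    rw [bracket_skewDiag_apply]
    simp

/-- An upper triangular matrix with distinct diagonal entries is diagonalizable. -/
theorem exists_diagonalize_upperTriangular {M : Matrix (Fin 3) (Fin 3) ℂ}
    (hM : M.BlockTriangular id) (h : Function.Injective fun i => M i i) :
    ∃ u w : Matrix (Fin 3) (Fin 3) ℂ, u * w = 1 ∧ u * M * w = diagonal fun i => M i i := by
  obtain ⟨m₁, m₂, m₃, m₁₂, m₁₃, m₂₃, rfl⟩ := exists_eq_of_upperTriangular hM
  have d01 : m₁ - m₂ ≠ 0 := sub_ne_zero.2 fun e => absurd (@h 0 1 e) (by decide)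
  have d02 : m₁ - m₃ ≠ 0 := sub_ne_zero.2 fun e => absurd (@h 0 2 e) (by decide)
  have d12 : m₂ - m₃ ≠ 0 := sub_ne_zero.2 fun e => absurd (@h 1 2 e) (by decide)
  -- The entries x, z, y of the unipotent u solve uM = Du, with D the diagonal of M.
  obtain ⟨x, hx⟩ : ∃ x, x * (m₁ - m₂) = m₁₂ := ⟨m₁₂ / (m₁ - m₂), by field_simp⟩
  obtain ⟨z, hz⟩ : ∃ z, z * (m₂ - m₃) = m₂₃ := ⟨m₂₃ / (m₂ - m₃), by field_simp⟩
  obtain ⟨y, hy⟩ : ∃ y, y * (m₁ - m₃) = m₁₃ + x * m₂₃ :=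
    ⟨(m₁₃ + x * m₂₃) / (m₁ - m₃), by field_simp⟩
  refine ⟨!![1, x, y; 0, 1, z; 0, 0, 1], !![1, -x, x * z - y; 0, 1, -z; 0, 0, 1], ?_, ?_⟩
  · ext i j
    fin_cases i <;> fin_cases j <;> simp [Matrix.mul_apply, Fin.sum_univ_three]
    ring
  · ext i j
    fin_cases i <;> fin_cases j <;> simp [Matrix.mul_apply, Fin.sum_univ_three]
    · linear_combination -hx
    · linear_combination z * hx - hy
    · linear_combination -hz

/-- When M has distinct eigenvalues, a Levi element diagonalizes it and a Siegel element removes N,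
which leaves a `skewDiag`. -/
theorem quartic_bracket_of_injective {N M : Matrix (Fin 3) (Fin 3) ℂ} (hN : Nᵀ = -N)
    (hM : M.BlockTriangular id) (h : Function.Injective fun i => M i i)
    {B : Matrix (Idx 3) (Idx 3) ℂ} (hB : Bᵀ = -B) :
    quartic (fromBlocks N M (-Mᵀ) 0 * stdJ 3 * B - B * stdJ 3 * fromBlocks N M (-Mᵀ) 0) = 0 := by
  obtain ⟨u, w, huw, hd⟩ := exists_diagonalize_upperTriangular hM h
  have hBg : ∀ g : Matrix (Idx 3) (Idx 3) ℂ, ∀ B : Matrix (Idx 3) (Idx 3) ℂ, Bᵀ = -B →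
      (g * B * gᵀ)ᵀ = -(g * B * gᵀ) := by
    intro g B hB
    simp [transpose_mul, hB, Matrix.mul_assoc]
  have hNu : (u * N * uᵀ)ᵀ = -(u * N * uᵀ) := by
    simp [transpose_mul, hN, Matrix.mul_assoc]
  have hNs : ∀ i j, (u * N * uᵀ) j i = -(u * N * uᵀ) i j := fun i j =>
    congrFun (congrFun hNu i) j
  set N' := u * N * uᵀ with hN'
  -- Solves N' + Dk - kD = 0 entrywise; k is symmetric because numerator and denominator are both
  -- skew. On the diagonal N' vanishes and the quotient 0/0 is 0.
  set k : Matrix (Fin 3) (Fin 3) ℂ := of fun i j => N' i j / (M j j - M i i) with hk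
  have hkT : kᵀ = k := by
    ext i j
    simp only [hk, transpose_apply, of_apply, hNs i j]
    rw [← neg_sub, div_neg, neg_div, neg_neg]
  have e1 := levi_congr (-1) u w N M
  have e2 := siegel_congr (-1) hkT N' (u * M * w)
  have e3 : fromBlocks (N' + (-1 : ℂ) • (k * (u * M * w)ᵀ) + u * M * w * k) (u * M * w)
      ((-1 : ℂ) • (u * M * w)ᵀ) 0 = skewDiag fun i => M i i := by
    rw [hd, skewDiag]
    congr 1
    · ext i j
      by_cases hij : i = j
      · subst hij
        have : N' i i = 0 := self_eq_neg.1 (hNs i i)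
        simp [hk, this, mul_comm]
      · have : M j j - M i i ≠ 0 := sub_ne_zero.2 fun e => hij (h e).symm
        simp [hk]
        field_simp
        ring
    · simp
  rw [← hN'] at e1
  simp only [neg_smul, one_smul] at e1 e2 e3
  rw [← quartic_congr (levi_mem huw), ← bracket_congr (levi_mem huw), e1,
    ← quartic_congr (siegel_mem hkT), ← bracket_congr (siegel_mem hkT), e2, e3]
  exact quartic_bracket_skewDiag _ (hBg _ _ (hBg _ _ hB))

/-- Extension by continuity: adding t·diag(0, 1, 2) to M keeps the first matrix skew and makes the
diagonal of M distinct for all but finitely many t. -/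
theorem IsBracket.quartic_eq_zero {S : Matrix (Idx 3) (Idx 3) ℂ} (hS : IsBracket S) :
    quartic S = 0 := by
  obtain ⟨A, B, hA, hB, rfl⟩ := hS
  obtain ⟨μ, g, hg, N, M, hN, hM, hμ, he⟩ := exists_isTri (ε := -1) A (by simpa using hA)
  simp only [neg_smul, one_smul] at he hN
  rw [← quartic_congr hg, ← bracket_congr hg, he]
  have hB' : (g * B * gᵀ)ᵀ = -(g * B * gᵀ) := by
    simp [transpose_mul, hB, Matrix.mul_assoc]
  set B' := g * B * gᵀ
  set E : Matrix (Fin 3) (Fin 3) ℂ := diagonal fun i => (i : ℂ)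
  let f : ℂ → ℂ := fun t => quartic (fromBlocks N (M + t • E) (-(M + t • E)ᵀ) 0 * stdJ 3 * B' -
    B' * stdJ 3 * fromBlocks N (M + t • E) (-(M + t • E)ᵀ) 0)
  have hcont : Continuous f := by
    have h1 : Continuous fun t : ℂ => M + t • E := by fun_prop
    have h2 : Continuous fun t : ℂ => fromBlocks N (M + t • E) (-(M + t • E)ᵀ) 0 :=
      Continuous.matrix_fromBlocks continuous_const h1 h1.matrix_transpose.neg continuous_const
    simp only [f, quartic]
    fun_prop
  have hfin : Set.Finite {t : ℂ | ¬ Function.Injective fun i => (M + t • E) i i} := by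
    refine Set.Finite.subset (s := Set.range fun q : Fin 3 × Fin 3 =>
      (M q.1 q.1 - M q.2 q.2) / (q.2 - q.1)) (Set.finite_range _) ?_
    intro t ht
    simp only [Set.mem_ofPred_eq, Function.Injective, not_forall] at ht
    obtain ⟨i, j, hij, hne⟩ := ht
    refine ⟨(i, j), ?_⟩
    have hji : ((j : ℕ) : ℂ) - ((i : ℕ) : ℂ) ≠ 0 := by
      rw [sub_ne_zero]
      exact fun e => hne (Fin.ext (by exact_mod_cast e.symm))
    have hij' : M i i + t * i = M j j + t * j := by simpa [E] using hij
    field_simp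
    linear_combination hij'
  have hzero : f = fun _ => 0 := by
    refine Continuous.ext_on (hfin.countable.dense_compl ℂ) hcont continuous_const ?_
    intro t ht
    simp only [Set.mem_compl_iff, Set.mem_ofPred_eq, not_not] at ht
    refine quartic_bracket_of_injective hN ?_ ht hB'
    refine hM.add fun i j hij => ?_
    have hne : i ≠ j := ne_of_gt hij
    simp [E, hne]
  simpa [f] using congrFun hzero 0

/-! ### n = 6: homogeneity and irreducibility of the quartic -/

open MvPolynomial in
theorem gammaPoly_eq_trace : gammaPoly 3 4 ^ 2 - 4 * gammaPoly 3 2 =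
    ((genericSym 3 * (stdJ 3).map C) ^ 4).trace -
      C 4⁻¹ * ((genericSym 3 * (stdJ 3).map C) ^ 2).trace ^ 2 := by
  refine MvPolynomial.funext fun x => ?_
  let S : SymMat 3 := ⟨of fun i j => x s(i, j), by ext i j; simp [Sym2.eq_swap]⟩
  have hx : x = symEntries S := by
    ext q
    induction q using Sym2.ind with
    | _ i j => rfl
  have hmap : (genericSym 3 * (stdJ 3).map C).map (eval x) = S.1 * stdJ 3 := by
    rw [Matrix.map_mul]
    congr 1
    · ext i j; simp [genericSym, S]
    · ext i j; simp
  have htr : ∀ k : ℕ, eval x ((genericSym 3 * (stdJ 3).map C) ^ k).trace =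
      ((S.1 * stdJ 3) ^ k).trace := by
    intro k
    rw [← hmap, ← Matrix.map_pow]
    exact AddMonoidHom.map_trace (eval x) _
  simp only [map_sub, map_mul, map_pow, htr, eval_C, map_ofNat]
  rw [hx, eval_gammaPoly, eval_gammaPoly]
  exact quartic_eq_pencil S.2

theorem eval_quartic (S : SymMat 3) :
    MvPolynomial.eval (symEntries S) (gammaPoly 3 4 ^ 2 - 4 * gammaPoly 3 2) = quartic S.1 := by
  simp only [map_sub, map_mul, map_pow, map_ofNat, eval_gammaPoly]
  exact quartic_eq_pencil S.2

theorem isHomogeneous_mul_apply {σ n : Type*} [Fintype n]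
    {P Q : Matrix n n (MvPolynomial σ ℂ)} {a b : ℕ} (hP : ∀ i j, (P i j).IsHomogeneous a)
    (hQ : ∀ i j, (Q i j).IsHomogeneous b) (i j : n) : ((P * Q) i j).IsHomogeneous (a + b) := by
  rw [Matrix.mul_apply]
  exact MvPolynomial.IsHomogeneous.sum _ _ _ fun k _ => (hP i k).mul (hQ k j)

theorem isHomogeneous_pow_apply {σ n : Type*} [Fintype n] [DecidableEq n]
    {P : Matrix n n (MvPolynomial σ ℂ)} (hP : ∀ i j, (P i j).IsHomogeneous 1) (k : ℕ) (i j : n) :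
    ((P ^ k) i j).IsHomogeneous k := by
  induction k generalizing i j with
  | zero =>
    rw [pow_zero, Matrix.one_apply]
    split_ifs
    · exact MvPolynomial.isHomogeneous_one _ _
    · exact MvPolynomial.isHomogeneous_zero _ _ _
  | succ k ih =>
    rw [pow_succ]
    exact isHomogeneous_mul_apply ih hP i j

open MvPolynomial in
theorem isHomogeneous_quartic : (gammaPoly 3 4 ^ 2 - 4 * gammaPoly 3 2).IsHomogeneous 4 := by
  have hZ : ∀ i j, ((genericSym 3 * (stdJ 3).map C :
      Matrix (Idx 3) (Idx 3) (MvPolynomial (Sym2 (Idx 3)) ℂ)) i j).IsHomogeneous 1 := by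
    intro i j
    exact isHomogeneous_mul_apply (a := 1) (b := 0) (fun i j => isHomogeneous_X _ _)
      (fun i j => isHomogeneous_C _ _) i j
  have htr : ∀ k : ℕ, (((genericSym 3 * (stdJ 3).map C) ^ k).trace).IsHomogeneous k := fun k =>
    IsHomogeneous.sum _ _ _ fun i _ => isHomogeneous_pow_apply hZ k i i
  rw [gammaPoly_eq_trace]
  refine (htr 4).sub ?_
  simpa using (isHomogeneous_C _ (4⁻¹ : ℂ)).mul ((htr 2).pow 2)

section
open Polynomial

/-- A plane section of the quartic hypersurface. -/
def planeSection : Matrix (Idx 3) (Idx 3) ℂ[X][X] :=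
  fromBlocks !![0, 0, 0; 0, 0, 0; 0, 0, 1] !![C X, 0, 0; 0, 0, 1; 0, 0, 0]
    !![C X, 0, 0; 0, 0, 0; 0, 1, 0] !![0, 0, 0; 0, X, 0; 0, 0, 0]

theorem planeSection_comm (i j : Idx 3) : planeSection i j = planeSection j i := by
  rcases i with i | i <;> rcases j with j | j <;> fin_cases i <;> fin_cases j <;>
    simp [planeSection]

theorem natDegree_eval_planeSection (i j : Idx 3) :
    ((planeSection i j).eval 0).natDegree ≤ 1 := by
  rcases i with i | i <;> rcases j with j | j <;> fin_cases i <;> fin_cases j <;>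
    simp [planeSection]

/-- The entries of `planeSection`, indexed by unordered pairs. -/
def planeSectionEntries : Sym2 (Idx 3) → ℂ[X][X] :=
  Sym2.lift ⟨fun i j => planeSection i j, planeSection_comm⟩

/-- With x the inner and y the outer variable, the quartic restricts to x⁴ + 4y, the equation of a
graph. -/
theorem aeval_planeSection_quartic :
    MvPolynomial.aeval planeSectionEntries (gammaPoly 3 4 ^ 2 - 4 * gammaPoly 3 2) =
      C (X ^ 4) + C (C 4) * X := by
  let ψ : MvPolynomial (Sym2 (Idx 3)) ℂ →+* ℂ[X][X] :=
    (MvPolynomial.aeval (R := ℂ) planeSectionEntries).toRingHom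
  have hψ : ∀ q, MvPolynomial.aeval planeSectionEntries q = ψ q := fun q => rfl
  have hmap : (genericSym 3 * (stdJ 3).map MvPolynomial.C).map ψ =
      planeSection * fromBlocks 0 1 (-1) 0 := by
    rw [Matrix.map_mul]
    congr 1
    · ext1 i j
      change MvPolynomial.aeval planeSectionEntries (MvPolynomial.X s(i, j)) = _
      rw [MvPolynomial.aeval_X]
      rfl
    · rw [stdJ, fromBlocks_map, fromBlocks_map]
      congr 1
      · ext1 i j; simp
      · ext1 i j; by_cases h : i = j <;> simp [Matrix.one_apply, h]
      · ext1 i j; by_cases h : i = j <;> simp [h]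
      · ext1 i j; simp
  have htr : ∀ k : ℕ, ψ ((genericSym 3 * (stdJ 3).map MvPolynomial.C) ^ k).trace =
      ((planeSection * fromBlocks 0 1 (-1) 0) ^ k).trace := by
    intro k
    rw [← hmap, ← Matrix.map_pow]
    exact AddMonoidHom.map_trace ψ _
  have hC : ψ (MvPolynomial.C 4⁻¹) = C (C 4⁻¹) := by
    rw [← hψ, MvPolynomial.aeval_C]; rfl
  have hC4 : (C (C 4) : ℂ[X][X]) = 4 := map_ofNat ((C : ℂ[X] →+* ℂ[X][X]).comp C) 4
  have h4 : C (C (4⁻¹ : ℂ)) * 4 = (1 : ℂ[X][X]) := by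
    rw [← hC4, ← C_mul, ← C_mul]
    norm_num
  have hT : ∀ A B D E : Matrix (Fin 3) (Fin 3) ℂ[X][X],
      (fromBlocks A B D E).trace = A.trace + E.trace := by
    intro A B D E
    simp [Matrix.trace]
  rw [gammaPoly_eq_trace, hψ]
  simp only [map_sub, map_mul, map_pow, htr, hC]
  rw [planeSection, fromBlocks_multiply, show 4 = 2 * 2 from rfl, pow_mul, pow_two, pow_two,
    fromBlocks_multiply, fromBlocks_multiply, hT, hT]
  simp only [Matrix.mul_zero, Matrix.mul_one, Matrix.mul_neg, zero_add, add_zero]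
  simp [Matrix.trace_fin_three]
  rw [hC4]
  linear_combination (-(C X : ℂ[X][X]) ^ 4) * h4

theorem irreducible_planeCurve :
    Irreducible (C (X ^ 4) + C (C 4) * X : ℂ[X][X]) := by
  have h4 : C (C (4 : ℂ)) * C (C (4⁻¹ : ℂ)) = (1 : ℂ[X][X]) := by
    rw [← C_mul, ← C_mul]; norm_num
  have hu : IsUnit (C (C (4 : ℂ)) : ℂ[X][X]) := IsUnit.of_mul_eq_one _ h4
  have e : (C (X ^ 4) + C (C 4) * X : ℂ[X][X]) =
      C (C 4) * (X - C (-(C 4⁻¹ * X ^ 4))) := by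
    simp only [C_neg, C_mul]
    linear_combination (-(C (X ^ 4) : ℂ[X][X])) * h4
  rw [e, irreducible_isUnit_mul hu]
  exact irreducible_X_sub_C _

/-- In a factorization F = GH, one factor, say G, restricts to a unit on the plane section. At y = 0
the section of F is x⁴ and its entries have degree at most 1 in x, so H has total degree at least 4
and G is constant. -/
theorem irreducible_quartic : Irreducible (gammaPoly 3 4 ^ 2 - 4 * gammaPoly 3 2) := by
  set F := gammaPoly 3 4 ^ 2 - 4 * gammaPoly 3 2 with hF
  have hψF := aeval_planeSection_quartic
  rw [← hF] at hψF
  have hF0 : F ≠ 0 := by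
    intro h0
    rw [h0, map_zero] at hψF
    exact irreducible_planeCurve.ne_zero hψF.symm
  have htF : F.totalDegree = 4 := isHomogeneous_quartic.totalDegree hF0
  have hconst : ∀ G H : MvPolynomial (Sym2 (Idx 3)) ℂ, F = G * H →
      IsUnit (MvPolynomial.aeval planeSectionEntries G) → IsUnit G := by
    intro G H hGH hu
    have hne : G ≠ 0 ∧ H ≠ 0 := by
      constructor <;> rintro rfl <;> simp [hF0] at hGH
    let θ : MvPolynomial (Sym2 (Idx 3)) ℂ →ₐ[ℂ] ℂ[X] :=
      MvPolynomial.aeval fun q => (planeSectionEntries q).eval 0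
    have hθ : ∀ q, θ q = (MvPolynomial.aeval planeSectionEntries q).eval 0 := by
      intro q
      induction q using MvPolynomial.induction_on with
      | C a => simp [θ]
      | add p q hp hq => simp [hp, hq]
      | mul_X p i hp => simp [hp, θ]
    have hθF : θ G * θ H = X ^ 4 := by
      rw [← map_mul, ← hGH, hθ, hψF]; simp
    have hGu : IsUnit (θ G) := by
      rw [hθ]
      exact hu.map (Polynomial.evalRingHom (0 : ℂ[X]))
    have hdegH : (θ H).natDegree = 4 := by
      have h0 : θ G ≠ 0 := hGu.ne_zero
      have h1 : θ H ≠ 0 := fun h1 => by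
        rw [h1, mul_zero] at hθF
        exact pow_ne_zero 4 X_ne_zero hθF.symm
      have := congrArg natDegree hθF
      rw [natDegree_mul h0 h1, natDegree_X_pow, natDegree_eq_zero_of_isUnit hGu] at this
      omega
    have hle : (θ H).natDegree ≤ H.totalDegree * 1 := by
      refine MvPolynomial.aeval_natDegree_le H le_rfl _ fun q => ?_
      induction q using Sym2.ind with
      | _ i j => exact natDegree_eval_planeSection i j
    have hsum : 4 = G.totalDegree + H.totalDegree := by
      rw [← MvPolynomial.totalDegree_mul_of_isDomain hne.1 hne.2, ← hGH, htF]
    have hG0 : G.totalDegree = 0 := by omega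
    rw [MvPolynomial.totalDegree_eq_zero_iff_eq_C] at hG0
    rw [hG0]
    refine IsUnit.map MvPolynomial.C (isUnit_iff_ne_zero.2 fun h => hne.1 ?_)
    rw [hG0, h, map_zero]
  refine ⟨fun hu => ?_, fun G H hGH => ?_⟩
  · exact irreducible_planeCurve.not_isUnit (hψF ▸ hu.map (MvPolynomial.aeval _))
  · have hm := hψF.symm
    rw [hGH, map_mul] at hm
    rcases irreducible_planeCurve.isUnit_or_isUnit hm with h | h
    · exact Or.inl (hconst G H hGH h)
    · exact Or.inr (hconst H G (by rw [hGH, mul_comm]) h)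
end

/-! ### n = 6: every zero of the quartic is a bracket -/

/-- Skew matrices with zero lower right block have brackets of the same shape. Once a and d solve
the commutator equation, the condition on N is linear in the skew blocks b and f. -/
theorem isBracket_parabolic {p : ℕ} {a b d f N M : Matrix (Fin p) (Fin p) ℂ} (hb : bᵀ = -b)
    (hf : fᵀ = -f) (hN : d * b + (d * b)ᵀ - (a * f + (a * f)ᵀ) = N) (hM : d * a - a * d = M) :
    IsBracket (fromBlocks N M Mᵀ 0) := by
  refine ⟨fromBlocks b a (-aᵀ) 0, fromBlocks f d (-dᵀ) 0, ?_, ?_, ?_⟩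
  · simp [fromBlocks_transpose, fromBlocks_neg, hb]
  · simp [fromBlocks_transpose, fromBlocks_neg, hf]
  · subst hN hM
    simp only [stdJ, fromBlocks_multiply, sub_eq_add_neg, fromBlocks_neg, fromBlocks_add]
    congr 1
    · simp [transpose_mul, hb, hf]
      abel
    · simp
      abel
    · simp [transpose_mul]
    · simp

theorem isBracket_levi_iff {p : ℕ} {u w : Matrix (Fin p) (Fin p) ℂ} (huw : u * w = 1)
    (N M : Matrix (Fin p) (Fin p) ℂ) :
    IsBracket (fromBlocks (u * N * uᵀ) (u * M * w) (u * M * w)ᵀ 0) ↔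
      IsBracket (fromBlocks N M Mᵀ 0) := by
  have h := levi_congr 1 u w N M
  rw [one_smul, one_smul] at h
  rw [← h, isBracket_congr_iff (levi_mem huw)]

theorem isBracket_siegel_iff {p : ℕ} {h : Matrix (Fin p) (Fin p) ℂ} (hh : hᵀ = h)
    (N M : Matrix (Fin p) (Fin p) ℂ) :
    IsBracket (fromBlocks (N + h * Mᵀ + M * h) M Mᵀ 0) ↔
      IsBracket (fromBlocks N M Mᵀ 0) := by
  have e := siegel_congr 1 hh N M
  rw [one_smul, one_smul] at e
  rw [← e, isBracket_congr_iff (siegel_mem hh)]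

/-- The symmetric `6 × 6` matrix with blocks `N`, `M`, `Mᵀ`, `0`, where `N` is symmetric. -/
def symBlocks (n₁₁ n₁₂ n₁₃ n₂₂ n₂₃ n₃₃ : ℂ) (M : Matrix (Fin 3) (Fin 3) ℂ) :
    Matrix (Idx 3) (Idx 3) ℂ :=
  fromBlocks !![n₁₁, n₁₂, n₁₃; n₁₂, n₂₂, n₂₃; n₁₃, n₂₃, n₃₃] M Mᵀ 0

theorem transpose_of_three {R : Type*} (a b c d e f g h k : R) :
    (!![a, b, c; d, e, f; g, h, k])ᵀ = !![a, d, g; b, e, h; c, f, k] := by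
  ext i j
  fin_cases i <;> fin_cases j <;> rfl

theorem skew_transpose (x y z : ℂ) :
    (!![0, x, y; -x, 0, z; -y, -z, 0])ᵀ = -!![0, x, y; -x, 0, z; -y, -z, 0] := by
  ext i j
  fin_cases i <;> fin_cases j <;> simp

section
variable {n₁₁ n₁₂ n₁₃ n₂₂ n₂₃ n₃₃ : ℂ}

/-- Here a is the nilpotent shift, and d with [d, a] = M exists because M has trace zero. The block
f absorbs n₁₁, n₁₂ and one combination of n₁₃ and n₂₂; the three hypotheses on b are what remains.
-/
theorem isBracket_of_solvable {m₁ m₂ m₃ m₁₂ m₁₃ m₂₃ b₁ b₂ b₃ : ℂ} (hm : m₁ + m₂ + m₃ = 0)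
    (h1 : n₃₃ = 2 * m₃ * b₃) (h2 : n₂₃ = -m₁ * b₂ + m₂₃ * b₃)
    (h3 : n₂₂ + 2 * n₁₃ = 2 * m₂ * b₁ + 2 * (m₁₂ + m₂₃) * b₂ + 2 * m₁₃ * b₃) :
    IsBracket (symBlocks n₁₁ n₁₂ n₁₃ n₂₂ n₂₃ n₃₃ !![m₁, m₁₂, m₁₃; 0, m₂, m₂₃; 0, 0, m₃]) := by
  refine isBracket_parabolic (a := !![0, 1, 0; 0, 0, 1; 0, 0, 0])
    (d := !![0, 0, 0; -m₁, -m₁₂, -m₁₃; 0, m₃, -(m₁₂ + m₂₃)])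
    (skew_transpose b₁ b₂ b₃)
    (skew_transpose (n₁₁ / 2) (n₁₂ - m₁₂ * b₁ - m₁₃ * b₂) (m₁ * b₁ - m₁₃ * b₃ + n₂₂ / 2)) ?_ ?_
  · ext i j
    fin_cases i <;> fin_cases j <;> simp
    · ring
    · linear_combination -(1/2) * h3 - b₁ * hm
    · ring
    · ring
    · linear_combination -h2
    · linear_combination -(1/2) * h3 - b₁ * hm
    · linear_combination -h2
    · linear_combination -h1
  · ext i j
    fin_cases i <;> fin_cases j <;> simp
    linear_combination -hm

/-- The conditions of `isBracket_of_solvable` are triangular in b₃, b₂, b₁ with pivots 2m₃, -m₁,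
2m₂. -/
theorem isBracket_of_ne_zero {m₁ m₂ m₃ m₁₂ m₁₃ m₂₃ : ℂ} (hm : m₁ + m₂ + m₃ = 0)
    (h1 : m₁ ≠ 0) (h2 : m₂ ≠ 0) (h3 : m₃ ≠ 0) :
    IsBracket (symBlocks n₁₁ n₁₂ n₁₃ n₂₂ n₂₃ n₃₃ !![m₁, m₁₂, m₁₃; 0, m₂, m₂₃; 0, 0, m₃]) := by
  obtain ⟨b₃, hb₃⟩ : ∃ b, n₃₃ = 2 * m₃ * b := ⟨n₃₃ / (2 * m₃), by field_simp⟩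
  obtain ⟨b₂, hb₂⟩ : ∃ b, n₂₃ = -m₁ * b + m₂₃ * b₃ := ⟨(m₂₃ * b₃ - n₂₃) / m₁, by field_simp; ring⟩
  obtain ⟨b₁, hb₁⟩ : ∃ b, n₂₂ + 2 * n₁₃ = 2 * m₂ * b + 2 * (m₁₂ + m₂₃) * b₂ + 2 * m₁₃ * b₃ :=
    ⟨(n₂₂ + 2 * n₁₃ - 2 * (m₁₂ + m₂₃) * b₂ - 2 * m₁₃ * b₃) / (2 * m₂), by field_simp; ring⟩
  exact isBracket_of_solvable hm hb₃ hb₂ hb₁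

theorem isBracket_levi {u w N M N' M' : Matrix (Fin 3) (Fin 3) ℂ} (huw : u * w = 1)
    (hN : u * N * uᵀ = N') (hM : u * M * w = M') (h : IsBracket (fromBlocks N' M' M'ᵀ 0)) :
    IsBracket (fromBlocks N M Mᵀ 0) := by
  subst hN hM
  exact (isBracket_levi_iff huw N M).1 h

theorem isBracket_diagonal {m α β : ℂ} :
    IsBracket (symBlocks 0 α 0 0 0 β !![m, 0, 0; 0, -m, 0; 0, 0, 0]) := by
  by_cases hβ : β = 0
  · subst hβ
    exact isBracket_of_solvable (b₁ := 0) (b₂ := 0) (b₃ := 0) (by ring) (by ring) (by ring)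
      (by ring)
  by_cases hα : α = 0
  · subst hα
    have h : IsBracket (symBlocks β 0 0 0 0 0 !![0, 0, 0; 0, m, 0; 0, 0, -m]) :=
      isBracket_of_solvable (b₁ := 0) (b₂ := 0) (b₃ := 0) (by ring) (by ring) (by ring) (by ring)
    refine isBracket_levi (u := !![0, 0, 1; 1, 0, 0; 0, 1, 0]) (w := !![0, 1, 0; 0, 0, 1; 1, 0, 0])
      ?_ ?_ ?_ h <;>
    · ext i j
      fin_cases i <;> fin_cases j <;> simp [transpose_of_three]
  -- Swapping the last two coordinates and rescaling the first achieves n₂₂ + 2n₁₃ = 0, so that b =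
  -- 0 solves the system.
  · have h : IsBracket (symBlocks 0 0 (-β / 2) β 0 0 !![m, 0, 0; 0, 0, 0; 0, 0, -m]) :=
      isBracket_of_solvable (b₁ := 0) (b₂ := 0) (b₃ := 0) (by ring) (by ring) (by ring) (by ring)
    have hx : -β / (2 * α) ≠ 0 := by simp [hα, hβ]
    refine isBracket_levi (u := !![-β / (2 * α), 0, 0; 0, 0, 1; 0, 1, 0])
      (w := !![(-β / (2 * α))⁻¹, 0, 0; 0, 0, 1; 0, 1, 0]) ?_ ?_ ?_ h <;>
    · ext i j
      fin_cases i <;> fin_cases j <;> simp [transpose_of_three] <;> field_simp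

/-- M has distinct eigenvalues m, -m, 0. After diagonalization a Siegel element clears every entry
of N at (i, j) with mᵢ + mⱼ ≠ 0, and only the positions (0, 1) and (2, 2) survive. -/
theorem isBracket_of_eigenvalues {m m₁₂ m₁₃ m₂₃ : ℂ} (hm : m ≠ 0) :
    IsBracket (symBlocks n₁₁ n₁₂ n₁₃ n₂₂ n₂₃ n₃₃ !![m, m₁₂, m₁₃; 0, -m, m₂₃; 0, 0, 0]) := by
  set M := !![m, m₁₂, m₁₃; 0, -m, m₂₃; 0, 0, 0] with hMdef
  have hM : M.BlockTriangular id := by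
    intro i j hij
    fin_cases i <;> fin_cases j <;> first | rfl | exact absurd hij (by decide)
  have hinj : Function.Injective fun i => M i i := by
    intro i j hij
    have hij' : ![m, -m, 0] i = ![m, -m, 0] j := by
      have hd : ∀ i, M i i = ![m, -m, 0] i := fun i => by fin_cases i <;> rfl
      simpa only [hd] using hij
    have h2 : m ≠ -m := fun h => hm (self_eq_neg.1 h)
    clear hij
    fin_cases i <;> fin_cases j <;> simp_all [eq_comm]
  obtain ⟨u, w, huw, hd⟩ := exists_diagonalize_upperTriangular hM hinj
  have hd' : u * M * w = !![m, 0, 0; 0, -m, 0; 0, 0, 0] := by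
    rw [hd]
    ext i j
    fin_cases i <;> fin_cases j <;> simp [M]
  refine isBracket_levi huw rfl hd' ?_
  set N : Matrix (Fin 3) (Fin 3) ℂ :=
    u * !![n₁₁, n₁₂, n₁₃; n₁₂, n₂₂, n₂₃; n₁₃, n₂₃, n₃₃] * uᵀ with hNdef
  have hN : Nᵀ = N := by
    have : (!![n₁₁, n₁₂, n₁₃; n₁₂, n₂₂, n₂₃; n₁₃, n₂₃, n₃₃])ᵀ =
        !![n₁₁, n₁₂, n₁₃; n₁₂, n₂₂, n₂₃; n₁₃, n₂₃, n₃₃] := by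
      ext i j
      fin_cases i <;> fin_cases j <;> rfl
    rw [hNdef, transpose_mul, transpose_mul, this, transpose_transpose, Matrix.mul_assoc]
  have hs : ∀ i j, N j i = N i j := fun i j => congrFun (congrFun hN i) j
  -- The entries are -Nᵢⱼ/(mᵢ + mⱼ), or 0 where the denominator vanishes.
  have key := isBracket_siegel_iff (h := !![-N 0 0 / (2 * m), 0, -N 0 2 / m;
      0, N 1 1 / (2 * m), N 1 2 / m; -N 0 2 / m, N 1 2 / m, 0])
    (by ext i j; fin_cases i <;> fin_cases j <;> rfl) N !![m, 0, 0; 0, -m, 0; 0, 0, 0]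
  refine key.1 ?_
  convert isBracket_diagonal (m := m) (α := N 0 1) (β := N 2 2) using 1
  rw [symBlocks]
  congr 1
  ext i j
  fin_cases i <;> fin_cases j <;> simp [transpose_of_three, hs 0 1, hs 0 2, hs 1 2] <;> field_simp <;> ring

/-- For nilpotent M, `isBracket_of_solvable` forces n₃₃ = 0. This other solution of [d, a] = M
leaves n₃₃ free, at the price of one relation. -/
theorem isBracket_regular_nilpotent_aux (h : n₂₂ = 2 * n₁₃) :
    IsBracket (symBlocks n₁₁ n₁₂ n₁₃ n₂₂ n₂₃ n₃₃ !![0, 1, 0; 0, 0, 1; 0, 0, 0]) := by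
  refine isBracket_parabolic (a := !![0, 0, -1; 0, 0, 0; 0, 0, 0])
    (d := !![0, 0, 0; -1, 0, 0; 0, 1, 0])
    (skew_transpose (-n₁₃) (-n₂₃) (n₃₃ / 2)) (skew_transpose 0 (-n₁₁ / 2) (-n₁₂)) ?_ ?_
  · ext i j
    fin_cases i <;> fin_cases j <;> simp
    rw [h]; ring
  · ext i j
    fin_cases i <;> fin_cases j <;> simp

theorem isBracket_regular_nilpotent {m₁₂ m₁₃ m₂₃ : ℂ} (h12 : m₁₂ ≠ 0) (h23 : m₂₃ ≠ 0)
    (h : n₃₃ ≠ 0) :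
    IsBracket (symBlocks n₁₁ n₁₂ n₁₃ n₂₂ n₂₃ n₃₃ !![0, m₁₂, m₁₃; 0, 0, m₂₃; 0, 0, 0]) := by
  have step : ∀ {n₁₁ n₁₂ n₁₃ n₂₂ n₂₃ : ℂ},
      IsBracket (symBlocks n₁₁ n₁₂ n₁₃ n₂₂ n₂₃ n₃₃ !![0, 1, 0; 0, 0, 1; 0, 0, 0]) := by
    intro n₁₁ n₁₂ n₁₃ n₂₂ n₂₃
    -- Conjugation by 1 + yE₁₃ fixes the Jordan block and shifts n₁₃ by y n₃₃, which restores the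
    -- relation.
    obtain ⟨y, hy⟩ : ∃ y, n₂₂ = 2 * (n₁₃ + y * n₃₃) :=
      ⟨(n₂₂ / 2 - n₁₃) / n₃₃, by field_simp; ring⟩
    refine isBracket_levi (u := !![1, 0, y; 0, 1, 0; 0, 0, 1])
      (w := !![1, 0, -y; 0, 1, 0; 0, 0, 1]) ?_ ?_ ?_
      (isBracket_regular_nilpotent_aux (n₁₁ := n₁₁ + y * n₁₃ + (n₁₃ + y * n₃₃) * y)
        (n₁₂ := n₁₂ + y * n₂₃) (n₂₃ := n₂₃) (n₃₃ := n₃₃) hy) <;>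
    · ext i j
      fin_cases i <;> fin_cases j <;> simp [transpose_of_three, mul_comm]
  set c := m₁₃ / (m₁₂ * m₂₃) with hc
  refine isBracket_levi (u := !![1 / (m₁₂ * m₂₃), -c / m₂₃, 0; 0, 1 / m₂₃, 0; 0, 0, 1])
    (w := !![m₁₂ * m₂₃, m₁₂ * m₂₃ * c, 0; 0, m₂₃, 0; 0, 0, 1]) ?_ ?_ ?_
    (step (n₁₁ := (n₁₁ / (m₁₂ * m₂₃) - c / m₂₃ * n₁₂) / (m₁₂ * m₂₃) -
        (n₁₂ / (m₁₂ * m₂₃) - c / m₂₃ * n₂₂) * c / m₂₃)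
      (n₁₂ := (n₁₂ / (m₁₂ * m₂₃) - c / m₂₃ * n₂₂) / m₂₃)
      (n₁₃ := n₁₃ / (m₁₂ * m₂₃) - c / m₂₃ * n₂₃) (n₂₂ := n₂₂ / m₂₃ / m₂₃)
      (n₂₃ := n₂₃ / m₂₃)) <;>
  · ext i j
    fin_cases i <;> fin_cases j <;> simp [transpose_of_three, hc] <;> field_simp <;> ring

theorem isBracket_regular_nilpotent' {m₁₂ m₁₃ m₂₃ : ℂ} (h12 : m₁₂ ≠ 0) (h23 : m₂₃ ≠ 0) :
    IsBracket (symBlocks n₁₁ n₁₂ n₁₃ n₂₂ n₂₃ 0 !![0, m₁₂, m₁₃; 0, 0, m₂₃; 0, 0, 0]) := by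
  have step : ∀ {n₁₁ n₁₂ n₁₃ n₂₂ n₂₃ m₁₂ m₁₃ : ℂ}, m₁₂ + m₂₃ ≠ 0 →
      IsBracket (symBlocks n₁₁ n₁₂ n₁₃ n₂₂ n₂₃ 0 !![0, m₁₂, m₁₃; 0, 0, m₂₃; 0, 0, 0]) := by
    intro n₁₁ n₁₂ n₁₃ n₂₂ n₂₃ m₁₂ m₁₃ hs
    refine isBracket_of_solvable (b₁ := 0) (b₃ := n₂₃ / m₂₃)
      (b₂ := (n₂₂ + 2 * n₁₃ - 2 * m₁₃ * (n₂₃ / m₂₃)) / (2 * (m₁₂ + m₂₃)))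
      (by ring) (by ring) ?_ ?_ <;>
    · field_simp
      ring
  -- If the pivot m₁₂ + m₂₃ vanishes, a diagonal Levi element doubles m₁₂ and makes it nonzero.
  by_cases hs : m₁₂ + m₂₃ = 0
  · refine isBracket_levi (u := !![2, 0, 0; 0, 1, 0; 0, 0, 1])
      (w := !![1 / 2, 0, 0; 0, 1, 0; 0, 0, 1]) ?_ ?_ ?_
      (step (n₁₁ := 4 * n₁₁) (n₁₂ := 2 * n₁₂) (n₁₃ := 2 * n₁₃) (n₂₂ := n₂₂) (n₂₃ := n₂₃)
        (m₁₂ := 2 * m₁₂) (m₁₃ := 2 * m₁₃) ?_)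
    · ext i j
      fin_cases i <;> fin_cases j <;> simp
    · ext i j
      fin_cases i <;> fin_cases j <;> simp [transpose_of_three] <;> ring
    · ext i j
      fin_cases i <;> fin_cases j <;> simp
    · intro h0
      exact h12 (by linear_combination h0 - hs)
  · exact step hs

/-- With b = 0 and a = x ⊕ K, the constant entry of f reproduces the lower 2 × 2 block of N. The
first row r of d must satisfy r(K - x) = (r₁, r₂), solvable when x is not an eigenvalue of K; D is
the characteristic polynomial of K at x. -/
theorem isBracket_rank_one_aux {r₁ r₂ : ℂ} :
    IsBracket (symBlocks 0 n₁₂ n₁₃ n₂₂ n₂₃ n₃₃ !![0, r₁, r₂; 0, 0, 0; 0, 0, 0]) := by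
  obtain ⟨x, hx⟩ : ∃ x : ℂ, x ^ 2 - n₂₃ ^ 2 + n₂₂ * n₃₃ ≠ 0 := by
    by_cases h : -n₂₃ ^ 2 + n₂₂ * n₃₃ = 0
    · exact ⟨1, by intro h'; exact one_ne_zero (by linear_combination h' - h)⟩
    · exact ⟨0, by intro h'; exact h (by linear_combination h')⟩
  set D := x ^ 2 - n₂₃ ^ 2 + n₂₂ * n₃₃ with hD
  refine isBracket_parabolic (b := !![0, 0, 0; -0, 0, 0; -0, -0, 0])
    (a := !![x, 0, 0; 0, n₂₃, -n₂₂; 0, n₃₃, -n₂₃])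
    (d := !![0, -(r₁ * (x + n₂₃) + r₂ * n₃₃) / D, (r₁ * n₂₂ - r₂ * (x - n₂₃)) / D;
      0, 0, 0; 0, 0, 0]) (skew_transpose 0 0 0)
    (skew_transpose (-((x + n₂₃) * n₁₂ - n₂₂ * n₁₃) / D) (-(n₃₃ * n₁₂ + (x - n₂₃) * n₁₃) / D)
      (-1 / 2)) ?_ ?_ <;>
  · ext i j
    fin_cases i <;> fin_cases j <;> simp [transpose_of_three] <;> field_simp <;>
      first | (rw [hD]; ring) | ring

/-- It suffices to make n₁₁ vanish: by a Siegel element if M ≠ 0, and by moving to an isotropic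
vector of N if M = 0. -/
theorem isBracket_rank_one {r₁ r₂ : ℂ} :
    IsBracket (symBlocks n₁₁ n₁₂ n₁₃ n₂₂ n₂₃ n₃₃ !![0, r₁, r₂; 0, 0, 0; 0, 0, 0]) := by
  have siegel : ∀ h₁ h₂ : ℂ, n₁₁ + 2 * (r₁ * h₁ + r₂ * h₂) = 0 →
      IsBracket (symBlocks n₁₁ n₁₂ n₁₃ n₂₂ n₂₃ n₃₃ !![0, r₁, r₂; 0, 0, 0; 0, 0, 0]) := by
    intro h₁ h₂ h0
    refine (isBracket_siegel_iff (h := !![0, h₁, h₂; h₁, 0, 0; h₂, 0, 0])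
      (by ext i j; fin_cases i <;> fin_cases j <;> rfl) _ _).1 ?_
    convert isBracket_rank_one_aux (n₁₂ := n₁₂) (n₁₃ := n₁₃) (n₂₂ := n₂₂) (n₂₃ := n₂₃)
      (n₃₃ := n₃₃) (r₁ := r₁) (r₂ := r₂) using 1
    rw [symBlocks]
    congr 1
    ext i j
    fin_cases i <;> fin_cases j <;> simp [transpose_of_three]
    linear_combination h0
  by_cases h1 : r₁ = 0
  · by_cases h2 : r₂ = 0
    · subst h1 h2
      by_cases h22 : n₂₂ = 0
      · subst h22
        refine isBracket_levi (u := !![0, 1, 0; 1, 0, 0; 0, 0, 1])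
          (w := !![0, 1, 0; 1, 0, 0; 0, 0, 1]) ?_ ?_ ?_
          (isBracket_rank_one_aux (n₁₂ := n₁₂) (n₁₃ := n₂₃) (n₂₂ := n₁₁) (n₂₃ := n₁₃)
            (n₃₃ := n₃₃) (r₁ := 0) (r₂ := 0)) <;>
        · ext i j
          fin_cases i <;> fin_cases j <;> simp [transpose_of_three]
      · obtain ⟨q, hq⟩ : ∃ q : ℂ, n₁₂ ^ 2 - n₁₁ * n₂₂ = q * q :=
          IsAlgClosed.exists_eq_mul_self _
        -- t is a root of n₁₁ + 2n₁₂t + n₂₂t² = 0.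
        obtain ⟨t, ht⟩ : ∃ t, n₂₂ * t = q - n₁₂ := ⟨(q - n₁₂) / n₂₂, by field_simp⟩
        refine isBracket_levi (u := !![1, t, 0; 0, 1, 0; 0, 0, 1])
          (w := !![1, -t, 0; 0, 1, 0; 0, 0, 1]) ?_ ?_ ?_
          (isBracket_rank_one_aux (n₁₂ := n₁₂ + t * n₂₂) (n₁₃ := n₁₃ + t * n₂₃) (n₂₂ := n₂₂)
            (n₂₃ := n₂₃) (n₃₃ := n₃₃) (r₁ := 0) (r₂ := 0))
        · ext i j
          fin_cases i <;> fin_cases j <;> simp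
        · ext i j
          fin_cases i <;> fin_cases j <;> simp [transpose_of_three]
          · refine mul_left_cancel₀ h22 ?_
            linear_combination (q + n₁₂ + n₂₂ * t) * ht - hq
          · ring
          · ring
        · ext i j
          fin_cases i <;> fin_cases j <;> simp
    · exact siegel 0 (-n₁₁ / (2 * r₂)) (by field_simp; ring)
  · exact siegel (-n₁₁ / (2 * r₁)) 0 (by field_simp; ring)

theorem isBracket_nilpotent {m₁₂ m₁₃ m₂₃ : ℂ} :
    IsBracket (symBlocks n₁₁ n₁₂ n₁₃ n₂₂ n₂₃ n₃₃ !![0, m₁₂, m₁₃; 0, 0, m₂₃; 0, 0, 0]) := by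
  by_cases h23 : m₂₃ = 0
  · subst h23
    exact isBracket_rank_one
  by_cases h12 : m₁₂ = 0
  · subst h12
    set c := m₁₃ / m₂₃ with hc
    have hc' : c * m₂₃ = m₁₃ := by rw [hc]; field_simp
    refine isBracket_levi (u := !![0, 1, 0; 1, -c, 0; 0, 0, 1])
      (w := !![c, 1, 0; 1, 0, 0; 0, 0, 1]) ?_ ?_ ?_
      (isBracket_rank_one (n₁₁ := n₂₂) (n₁₂ := n₁₂ - c * n₂₂) (n₁₃ := n₂₃)
        (n₂₂ := n₁₁ - c * n₁₂ - (n₁₂ - c * n₂₂) * c) (n₂₃ := n₁₃ - c * n₂₃) (n₃₃ := n₃₃)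
        (r₁ := 0) (r₂ := m₂₃)) <;>
    · ext i j
      fin_cases i <;> fin_cases j <;> simp [transpose_of_three, ← hc'] <;> ring
  by_cases h33 : n₃₃ = 0
  · subst h33
    exact isBracket_regular_nilpotent' h12 h23
  · exact isBracket_regular_nilpotent h12 h23 h33

end

theorem eq_symBlocks {N M : Matrix (Fin 3) (Fin 3) ℂ} (hN : Nᵀ = N) : fromBlocks N M Mᵀ 0 =
    symBlocks (N 0 0) (N 0 1) (N 0 2) (N 1 1) (N 1 2) (N 2 2) M := by
  rw [symBlocks]
  congr 1
  have hs : ∀ i j, N j i = N i j := fun i j => congrFun (congrFun hN i) j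
  conv_lhs => rw [eta_fin_three N, hs 0 1, hs 0 2, hs 1 2]

theorem exists_symBlocks_of_isTri {S : Matrix (Idx 3) (Idx 3) ℂ} {μ : Fin 3 → ℂ}
    (h : IsTri 1 S μ) : ∃ n₁₁ n₁₂ n₁₃ n₂₂ n₂₃ n₃₃ m₁₂ m₁₃ m₂₃ : ℂ,
      (IsBracket (symBlocks n₁₁ n₁₂ n₁₃ n₂₂ n₂₃ n₃₃
        !![μ 0, m₁₂, m₁₃; 0, μ 1, m₂₃; 0, 0, μ 2]) → IsBracket S) := by
  obtain ⟨g, hg, N, M, hN, hM, hμ, he⟩ := h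
  obtain ⟨m₁, m₂, m₃, m₁₂, m₁₃, m₂₃, rfl⟩ := exists_eq_of_upperTriangular hM
  rw [one_smul] at he hN
  rw [eq_symBlocks hN] at he
  refine ⟨N 0 0, N 0 1, N 0 2, N 1 1, N 1 2, N 2 2, m₁₂, m₁₃, m₂₃, fun hb => ?_⟩
  rw [← isBracket_congr_iff hg, he]
  rw [← hμ 0, ← hμ 1, ← hμ 2] at hb
  exact hb

/-- The pencil sees only the squares of the diagonal entries, so their order and signs are free. -/
theorem isTri_of_sq {S : Matrix (Idx 3) (Idx 3) ℂ} (hS : Sᵀ = S) {a b c a' b' c' : ℂ}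
    (h : IsTri 1 S ![a, b, c])
    (he : ∀ x : ℂ, (x - a ^ 2) * (x - b ^ 2) * (x - c ^ 2) =
      (x - a' ^ 2) * (x - b' ^ 2) * (x - c' ^ 2)) : IsTri 1 S ![a', b', c'] := by
  refine isTri_of_pencil_eq S (by simpa using hS) _ ?_
  rw [h.pencil_eq]
  refine Polynomial.funext fun x => ?_
  simp only [Fin.prod_univ_three, one_mul, Polynomial.eval_mul, Polynomial.eval_sub,
    Polynomial.eval_add, Polynomial.eval_X, Polynomial.eval_C]
  simp only [Matrix.cons_val]
  linear_combination he (x ^ 2)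

/-- If some entry vanishes, the diagonal can be arranged as (m, -m, 0); otherwise all three pivots
are nonzero. -/
theorem isBracket_of_isTri {S : Matrix (Idx 3) (Idx 3) ℂ} (hS : Sᵀ = S) {a b c : ℂ}
    (h : IsTri 1 S ![a, b, c]) (hsum : a + b + c = 0) : IsBracket S := by
  have key : ∀ m : ℂ, IsTri 1 S ![m, -m, 0] → IsBracket S := by
    intro m hm
    obtain ⟨n₁₁, n₁₂, n₁₃, n₂₂, n₂₃, n₃₃, m₁₂, m₁₃, m₂₃, hb⟩ := exists_symBlocks_of_isTri hm
    refine hb ?_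
    by_cases h0 : m = 0
    · subst h0
      simpa using isBracket_nilpotent (n₁₁ := n₁₁)
    · simpa using isBracket_of_eigenvalues (n₁₁ := n₁₁) h0
  by_cases hc : c = 0
  · subst hc
    refine key a (isTri_of_sq hS h fun x => ?_)
    obtain rfl : b = -a := by linear_combination hsum
    ring
  by_cases hb : b = 0
  · subst hb
    refine key a (isTri_of_sq hS h fun x => ?_)
    obtain rfl : c = -a := by linear_combination hsum
    ring
  by_cases ha : a = 0
  · subst ha
    refine key b (isTri_of_sq hS h fun x => ?_)
    obtain rfl : c = -b := by linear_combination hsum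
    ring
  obtain ⟨n₁₁, n₁₂, n₁₃, n₂₂, n₂₃, n₃₃, m₁₂, m₁₃, m₂₃, h'⟩ := exists_symBlocks_of_isTri h
  exact h' (isBracket_of_ne_zero hsum ha hb hc)

theorem isBracket_of_quartic_eq_zero {S : Matrix (Idx 3) (Idx 3) ℂ} (hS : Sᵀ = S)
    (h : quartic S = 0) : IsBracket S := by
  obtain ⟨μ, hμ⟩ := exists_isTri (ε := 1) S (by simpa using hS)
  have hq : 2 * (∑ i, μ i ^ 4) - (∑ i, μ i ^ 2) ^ 2 = 0 := by
    obtain ⟨g, hg, N, M, hN, hM, hd, he⟩ := hμ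
    rw [one_smul] at he
    rw [← quartic_congr hg, he, quartic_fromBlocks hM] at h
    simpa only [hd] using h
  obtain ⟨a, b, c, rfl⟩ : ∃ a b c, μ = ![a, b, c] :=
    ⟨μ 0, μ 1, μ 2, by ext i; fin_cases i <;> rfl⟩
  simp only [Fin.sum_univ_three, Matrix.cons_val] at hq
  -- Heron's factorization: each factor is a + b + c up to sign changes, which `isTri_of_sq`
  -- permits.
  have hprod : (a + b + c) * ((a + b + -c) * ((a + -b + c) * (-a + b + c))) = 0 := by
    linear_combination -hq
  rcases mul_eq_zero.1 hprod with h1 | h1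
  · exact isBracket_of_isTri hS hμ h1
  rcases mul_eq_zero.1 h1 with h1 | h1
  · exact isBracket_of_isTri hS (isTri_of_sq hS hμ fun x => by ring) h1
  rcases mul_eq_zero.1 h1 with h1 | h1
  · exact isBracket_of_isTri hS (isTri_of_sq hS hμ fun x => by ring) h1
  · exact isBracket_of_isTri hS (isTri_of_sq hS hμ fun x => by ring) h1

theorem ran_phi_three :
    (phi 3).ran = symZeroLocus 3 (gammaPoly 3 4 ^ 2 - 4 * gammaPoly 3 2) := by
  ext x
  have h1 := mem_ran_phi_mk x.rep x.rep_nonzero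
  rw [Projectivization.mk_rep] at h1
  rw [h1, symZeroLocus, Set.mem_ofPred_eq, eval_quartic]
  exact ⟨IsBracket.quartic_eq_zero, isBracket_of_quartic_eq_zero x.rep.2⟩

/-! ### The case n = 4 -/

/-- The `5`-dimensional complement of `J` in the skew-symmetric `4 × 4` matrices. -/
def skewOfVec : (Fin 5 → ℂ) →ₗ[ℂ] SkewMat 2 where
  toFun x := ⟨fromBlocks !![0, x 0; -x 0, 0] !![x 2, x 3; x 4, -x 2]
      !![-x 2, -x 4; -x 3, x 2] !![0, x 1; -x 1, 0], by
    change (_)ᵀ = -_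
    rw [fromBlocks_transpose, fromBlocks_neg]
    congr 1 <;> ext i j <;> fin_cases i <;> fin_cases j <;> simp⟩
  map_add' x y := by
    apply Subtype.ext
    change fromBlocks _ _ _ _ = fromBlocks _ _ _ _ + fromBlocks _ _ _ _
    rw [fromBlocks_add]
    congr 1 <;> ext i j <;> fin_cases i <;> fin_cases j <;> simp <;> ring
  map_smul' c x := by
    apply Subtype.ext
    change fromBlocks _ _ _ _ = c • fromBlocks _ _ _ _
    rw [fromBlocks_smul]
    congr 1 <;> ext i j <;> fin_cases i <;> fin_cases j <;> simp

theorem skewOfVec_apply (x : Fin 5 → ℂ) : (skewOfVec x).1 =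
    fromBlocks !![0, x 0; -x 0, 0] !![x 2, x 3; x 4, -x 2]
      !![-x 2, -x 4; -x 3, x 2] !![0, x 1; -x 1, 0] := rfl

theorem exists_eq_skewOfVec_add {A : Matrix (Idx 2) (Idx 2) ℂ} (hA : Aᵀ = -A) :
    ∃ (x : Fin 5 → ℂ) (s : ℂ), A = (skewOfVec x).1 + s • stdJ 2 := by
  have hs : ∀ i j, A i j = -A j i := fun i j => congrFun (congrFun hA j) i
  have h0 : ∀ i, A i i = 0 := fun i => self_eq_neg.1 (hs i i)
  refine ⟨![A (.inl 0) (.inl 1), A (.inr 0) (.inr 1),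
    (A (.inl 0) (.inr 0) - A (.inl 1) (.inr 1)) / 2, A (.inl 0) (.inr 1),
    A (.inl 1) (.inr 0)], (A (.inl 0) (.inr 0) + A (.inl 1) (.inr 1)) / 2, ?_⟩
  rw [skewOfVec_apply, stdJ, fromBlocks_smul, fromBlocks_add, ← fromBlocks_toBlocks A]
  congr 1 <;> ext i j <;> fin_cases i <;> fin_cases j <;>
    simp [toBlocks₁₁, toBlocks₁₂, toBlocks₂₁, toBlocks₂₂, h0]
  · exact hs _ _
  · ring
  · ring
  · rw [hs]; ring
  · exact hs _ _
  · exact hs _ _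
  · rw [hs]; ring
  · exact hs _ _

/-- J lies in the radical of the bracket, since JJB = -B = BJJ. -/
theorem bracket_add_smul_stdJ {p : ℕ} (A B : Matrix (Idx p) (Idx p) ℂ) (s t : ℂ) :
    (A + s • stdJ p) * stdJ p * (B + t • stdJ p) - (B + t • stdJ p) * stdJ p * (A + s • stdJ p) =
      A * stdJ p * B - B * stdJ p * A := by
  have h : ∀ C D : Matrix (Idx p) (Idx p) ℂ, ∀ a b : ℂ,
      (C + a • stdJ p) * stdJ p * (D + b • stdJ p) =
        C * stdJ p * D - b • C - a • D - (a * b) • stdJ p := by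
    intro C D a b
    have h1 : C * stdJ p * stdJ p = -C := by
      rw [Matrix.mul_assoc, stdJ_mul_stdJ, Matrix.mul_neg, Matrix.mul_one]
    simp only [Matrix.add_mul, Matrix.mul_add, smul_mul_assoc, mul_smul_comm, stdJ_mul_stdJ, h1,
      neg_mul, Matrix.one_mul]
    module
  rw [h, h, mul_comm t s]
  abel

theorem phiLift_skewOfVec (x y : Fin 5 → ℂ) : (phiLift 2 (skewOfVec x, skewOfVec y)).1 =
    fromBlocks
      !![-2 * (x 0 * y 3 - x 3 * y 0), 2 * (x 0 * y 2 - x 2 * y 0);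
        2 * (x 0 * y 2 - x 2 * y 0), 2 * (x 0 * y 4 - x 4 * y 0)]
      !![-(x 3 * y 4 - x 4 * y 3) - (x 0 * y 1 - x 1 * y 0), -2 * (x 2 * y 3 - x 3 * y 2);
        2 * (x 2 * y 4 - x 4 * y 2), (x 3 * y 4 - x 4 * y 3) - (x 0 * y 1 - x 1 * y 0)]
      !![-(x 3 * y 4 - x 4 * y 3) - (x 0 * y 1 - x 1 * y 0), 2 * (x 2 * y 4 - x 4 * y 2);
        -2 * (x 2 * y 3 - x 3 * y 2), (x 3 * y 4 - x 4 * y 3) - (x 0 * y 1 - x 1 * y 0)]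
      !![-2 * (x 1 * y 4 - x 4 * y 1), 2 * (x 1 * y 2 - x 2 * y 1);
        2 * (x 1 * y 2 - x 2 * y 1), 2 * (x 1 * y 3 - x 3 * y 1)] := by
  change (skewOfVec x).1 * stdJ 2 * (skewOfVec y).1 - (skewOfVec y).1 * stdJ 2 * (skewOfVec x).1 = _
  rw [skewOfVec_apply, skewOfVec_apply, stdJ]
  simp only [fromBlocks_multiply, sub_eq_add_neg, fromBlocks_neg, fromBlocks_add]
  congr 1 <;> ext i j <;> fin_cases i <;> fin_cases j <;> simp <;> ring

theorem phiLift_add_left {p : ℕ} (A A' B : SkewMat p) :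
    phiLift p (A + A', B) = phiLift p (A, B) + phiLift p (A', B) := by
  apply Subtype.ext
  simp only [phiLift, Submodule.coe_add, Matrix.add_mul, Matrix.mul_add]
  abel

theorem phiLift_add_right {p : ℕ} (A B B' : SkewMat p) :
    phiLift p (A, B + B') = phiLift p (A, B) + phiLift p (A, B') := by
  apply Subtype.ext
  simp only [phiLift, Submodule.coe_add, Matrix.add_mul, Matrix.mul_add]
  abel

theorem phiLift_smul_left {p : ℕ} (c : ℂ) (A B : SkewMat p) :
    phiLift p (c • A, B) = c • phiLift p (A, B) := by
  apply Subtype.ext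
  simp [phiLift, smul_sub]

theorem phiLift_smul_right {p : ℕ} (c : ℂ) (A B : SkewMat p) :
    phiLift p (A, c • B) = c • phiLift p (A, B) := by
  apply Subtype.ext
  simp [phiLift, smul_sub]

theorem phiLift_self {p : ℕ} (A : SkewMat p) : phiLift p (A, A) = 0 := by
  apply Subtype.ext
  simp [phiLift]

/-- The alternating map `(x, y) ↦ AJB - BJA` on `ℂ⁵`. -/
def bracketAlternating : (Fin 5 → ℂ) [⋀^Fin 2]→ₗ[ℂ] SymMat 2 where
  toFun v := phiLift 2 (skewOfVec (v 0), skewOfVec (v 1))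
  map_update_add' v i x y := by
    fin_cases i <;> simp [phiLift_add_left, phiLift_add_right]
  map_update_smul' v i c x := by
    fin_cases i <;> simp [phiLift_smul_left, phiLift_smul_right]
  map_eq_zero_of_eq' v i j h hij := by
    fin_cases i <;> fin_cases j <;> simp_all [phiLift_self]

/-- The linear map `Λ²ℂ⁵ → S²ℂ⁴` induced by the bracket. -/
def bracketLinear : (⋀[ℂ]^2 (Fin 5 → ℂ)) →ₗ[ℂ] SymMat 2 :=
  exteriorPower.alternatingMapLinearEquiv bracketAlternating

theorem bracketLinear_ιMulti (v : Fin 2 → Fin 5 → ℂ) :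
    bracketLinear (exteriorPower.ιMulti ℂ 2 v) =
      phiLift 2 (skewOfVec (v 0), skewOfVec (v 1)) := by
  rw [bracketLinear, exteriorPower.alternatingMapLinearEquiv_apply_ιMulti]
  rfl

theorem bracketLinear_surjective : Function.Surjective bracketLinear := by
  intro S
  have hs : ∀ i j, S.1 i j = S.1 j i := fun i j => congrFun (congrFun S.2 j) i
  let w : Fin 5 → Fin 5 → ⋀[ℂ]^2 (Fin 5 → ℂ) := fun i j =>
    exteriorPower.ιMulti ℂ 2 ![Pi.single i 1, Pi.single j 1]
  let a := S.1
  -- The coefficients invert the formulas of `phiLift_skewOfVec`, in which the entries are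
  -- combinations of the ten minors of (x, y).
  refine ⟨(-a (.inl 0) (.inl 0) / 2) • w 0 3 + (a (.inl 0) (.inl 1) / 2) • w 0 2 +
    (a (.inl 1) (.inl 1) / 2) • w 0 4 +
    (-(a (.inl 0) (.inr 0) + a (.inl 1) (.inr 1)) / 2) • w 0 1 +
    ((a (.inl 1) (.inr 1) - a (.inl 0) (.inr 0)) / 2) • w 3 4 +
    (-a (.inl 0) (.inr 1) / 2) • w 2 3 + (a (.inl 1) (.inr 0) / 2) • w 2 4 +
    (-a (.inr 0) (.inr 0) / 2) • w 1 4 + (a (.inr 0) (.inr 1) / 2) • w 1 2 +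
    (a (.inr 1) (.inr 1) / 2) • w 1 3, ?_⟩
  apply Subtype.ext
  simp only [w, map_add, map_smul, bracketLinear_ιMulti, Submodule.coe_add, Submodule.coe_smul,
    phiLift_skewOfVec, fromBlocks_smul, fromBlocks_add]
  rw [← fromBlocks_toBlocks S.1]
  congr 1 <;> ext i j <;> fin_cases i <;> fin_cases j <;>
    simp [toBlocks₁₁, toBlocks₁₂, toBlocks₂₁, toBlocks₂₂, a]
  · exact hs _ _
  · ring
  · ring
  · rw [hs (.inr 0)]; ring
  · exact hs _ _
  · exact hs _ _
  · rw [hs (.inr 1)]; ring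
  · exact hs _ _

/-- A symmetric matrix is determined by its entries at unordered pairs. -/
def symEntriesEquiv (p : ℕ) : (Sym2 (Idx p) → ℂ) ≃ₗ[ℂ] SymMat p where
  toFun x := ⟨of fun i j => x s(i, j), by ext i j; simp [Sym2.eq_swap]⟩
  invFun := symEntries
  map_add' x y := rfl
  map_smul' c x := rfl
  left_inv x := by
    ext q
    induction q using Sym2.ind with
    | _ i j => rfl
  right_inv S := rfl

theorem finrank_symMat_two : Module.finrank ℂ (SymMat 2) = 10 := by
  rw [← (symEntriesEquiv 2).finrank_eq, Module.finrank_fintype_fun_eq_card, Sym2.card]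
  simp [Nat.choose]

theorem bracketLinear_bijective : Function.Bijective bracketLinear := by
  have : FiniteDimensional ℂ (SymMat 2) := (symEntriesEquiv 2).finiteDimensional
  refine ⟨?_, bracketLinear_surjective⟩
  rw [LinearMap.injective_iff_surjective_of_finrank_eq_finrank]
  · exact bracketLinear_surjective
  · rw [exteriorPower.finrank_eq, finrank_symMat_two]
    simp [Nat.choose]

theorem exists_ran_phi_two : ∃ e : (⋀[ℂ]^2 (Fin 5 → ℂ)) ≃ₗ[ℂ] SymMat 2,
    (phi 2).ran =
      Projectivization.map e.toLinearMap e.injective '' pluckerGrassmannian 2 5 := by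
  let e := LinearEquiv.ofBijective bracketLinear bracketLinear_bijective
  have he : ∀ x, e x = bracketLinear x := fun x => rfl
  refine ⟨e, ?_⟩
  ext x
  induction x using Projectivization.ind with
  | h S hS =>
    rw [mem_ran_phi_mk, Set.mem_image]
    constructor
    · rintro ⟨A, B, hA, hB, hAB⟩
      obtain ⟨x, s, rfl⟩ := exists_eq_skewOfVec_add hA
      obtain ⟨y, t, rfl⟩ := exists_eq_skewOfVec_add hB
      rw [bracket_add_smul_stdJ] at hAB
      have hS' : e (exteriorPower.ιMulti ℂ 2 ![x, y]) = S := by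
        rw [he, bracketLinear_ιMulti]
        exact Subtype.ext hAB
      have hw : exteriorPower.ιMulti ℂ 2 ![x, y] ≠ 0 := by
        intro h0
        rw [h0, map_zero] at hS'
        exact hS hS'.symm
      refine ⟨Projectivization.mk ℂ _ hw, ⟨![x, y], ?_, ?_⟩, ?_⟩
      · by_contra hli
        exact hw (AlternatingMap.map_linearDependent _ _ hli)
      · rw [Projectivization.submodule_mk]
      · rw [Projectivization.map_mk]
        congr 1
    · rintro ⟨y, ⟨v, -, hv⟩, hy⟩
      induction y using Projectivization.ind with
      | h w hw =>
        rw [Projectivization.map_mk] at hy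
        obtain ⟨c, hc⟩ := (Projectivization.mk_eq_mk_iff' ℂ _ _ _ _).1 hy.symm
        rw [Projectivization.submodule_mk] at hv
        have hmem : w ∈ Submodule.span ℂ {exteriorPower.ιMulti ℂ 2 v} :=
          hv ▸ Submodule.mem_span_singleton_self w
        obtain ⟨d, rfl⟩ := Submodule.mem_span_singleton.1 hmem
        have hb : IsBracket (phiLift 2 (skewOfVec (v 0), skewOfVec (v 1))).1 :=
          ⟨_, _, (skewOfVec (v 0)).2, (skewOfVec (v 1)).2, rfl⟩
        have hS' : S = c • d • phiLift 2 (skewOfVec (v 0), skewOfVec (v 1)) := by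
          rw [← hc, ← bracketLinear_ιMulti, ← map_smul bracketLinear]
          rfl
        rw [hS']
        exact (hb.smul d).smul c

/-! ### Density in the Zariski topology -/

section Zariski
variable {M : Type*} [AddCommGroup M] [Module ℂ M]

/-- The value at a vector of a polynomial in linear forms. -/
def evalAt (v : M) : MvPolynomial (Module.Dual ℂ M) ℂ →+* ℂ :=
  MvPolynomial.eval fun l : Module.Dual ℂ M => l v

theorem evalAt_smul {P : MvPolynomial (Module.Dual ℂ M) ℂ} {d : ℕ} (hP : P.IsHomogeneous d)
    (c : ℂ) (v : M) : evalAt (c • v) P = c ^ d * evalAt v P := by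
  simp only [evalAt, MvPolynomial.eval_eq, Finset.mul_sum]
  refine Finset.sum_congr rfl fun m hm => ?_
  have hd : ∑ i ∈ m.support, m i = d := by
    rw [← Finsupp.degree_apply, Finsupp.degree_eq_weight_one]
    exact hP (MvPolynomial.mem_support_iff.1 hm)
  simp only [map_smul, smul_eq_mul, mul_pow, Finset.prod_mul_distrib, Finset.prod_pow_eq_pow_sum,
    hd]
  ring

theorem evalAt_rep_ne_zero_iff {P : MvPolynomial (Module.Dual ℂ M) ℂ} {d : ℕ}
    (hP : P.IsHomogeneous d) (v : M) (hv : v ≠ 0) :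
    evalAt (Projectivization.mk ℂ v hv).rep P ≠ 0 ↔ evalAt v P ≠ 0 := by
  obtain ⟨a, ha⟩ := Projectivization.exists_smul_eq_mk_rep ℂ v hv
  rw [← ha, Units.smul_def, evalAt_smul hP]
  simp

theorem exists_polynomial_line (P : MvPolynomial (Module.Dual ℂ M) ℂ) (v u : M) :
    ∃ q : Polynomial ℂ, ∀ t, q.eval t = evalAt (v + t • u) P := by
  refine ⟨MvPolynomial.aeval (fun l : Module.Dual ℂ M =>
    Polynomial.C (l v) + Polynomial.C (l u) * Polynomial.X) P, fun t => ?_⟩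
  induction P using MvPolynomial.induction_on with
  | C a => simp [evalAt]
  | add p q hp hq => rw [map_add, Polynomial.eval_add, hp, hq, map_add]
  | mul_X p l hp =>
    rw [map_mul, Polynomial.eval_mul, hp, map_mul]
    congr 1
    simp [evalAt, mul_comm t]

/-- The basic open subsets of projective space. -/
def basicOpen (P : MvPolynomial (Module.Dual ℂ M) ℂ) : Set (ℙ ℂ M) :=
  {x | evalAt x.rep P ≠ 0}

theorem mk_mem_basicOpen {P : MvPolynomial (Module.Dual ℂ M) ℂ} {d : ℕ}
    (hP : P.IsHomogeneous d) (v : M) (hv : v ≠ 0) :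
    Projectivization.mk ℂ v hv ∈ basicOpen P ↔ evalAt v P ≠ 0 :=
  evalAt_rep_ne_zero_iff hP v hv

theorem isOpen_basicOpen {P : MvPolynomial (Module.Dual ℂ M) ℂ} {d : ℕ}
    (hP : P.IsHomogeneous d) : IsOpen[zariskiTopology M] (basicOpen P) :=
  TopologicalSpace.isOpen_generateFrom_of_mem ⟨d, P, hP, rfl⟩

theorem basicOpen_mul (P Q : MvPolynomial (Module.Dual ℂ M) ℂ) :
    basicOpen (P * Q) = basicOpen P ∩ basicOpen Q := by
  ext x
  simp [basicOpen, not_or]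

theorem isTopologicalBasis_basicOpen :
    @TopologicalSpace.IsTopologicalBasis _ (zariskiTopology M)
      {U | ∃ (d : ℕ) (P : MvPolynomial (Module.Dual ℂ M) ℂ), P.IsHomogeneous d ∧
        U = basicOpen P} := by
  let _ := zariskiTopology M
  have h := TopologicalSpace.isTopologicalBasis_of_subbasis_of_inter
    (t := zariskiTopology M) (r := {U | ∃ (d : ℕ) (P : MvPolynomial (Module.Dual ℂ M) ℂ),
      P.IsHomogeneous d ∧ U = basicOpen P}) rfl (by
    rintro _ ⟨d, P, hP, rfl⟩ _ ⟨d', P', hP', rfl⟩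
    exact ⟨d + d', P * P', hP.mul hP', (basicOpen_mul P P').symm⟩)
  rwa [Set.insert_eq_of_mem] at h
  exact ⟨0, 1, MvPolynomial.isHomogeneous_one _ _, by simp [basicOpen]⟩

/-- Irreducibility of projective space: on the line through two representatives, nonzero
one-variable polynomials have a common nonzero. The linear form l keeps the chosen point away from
the zero vector. -/
theorem basicOpen_inter_nonempty {P Q : MvPolynomial (Module.Dual ℂ M) ℂ} {d e : ℕ}
    (hP : P.IsHomogeneous d) (hQ : Q.IsHomogeneous e) (h1 : (basicOpen P).Nonempty)
    (h2 : (basicOpen Q).Nonempty) : (basicOpen P ∩ basicOpen Q).Nonempty := by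
  obtain ⟨x, hx⟩ := h1
  obtain ⟨y, hy⟩ := h2
  obtain ⟨l, hl⟩ := Module.Projective.exists_dual_ne_zero ℂ x.rep_nonzero
  obtain ⟨a, ha⟩ := exists_polynomial_line P x.rep (y.rep - x.rep)
  obtain ⟨b, hb⟩ := exists_polynomial_line Q x.rep (y.rep - x.rep)
  obtain ⟨c, hc⟩ := exists_polynomial_line (MvPolynomial.X l) x.rep (y.rep - x.rep)
  have ha0 : a ≠ 0 := by
    rintro rfl
    have := ha 0
    simp only [zero_smul, add_zero, Polynomial.eval_zero] at this
    exact hx this.symm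
  have hb0 : b ≠ 0 := by
    rintro rfl
    have := hb 1
    simp only [one_smul, add_sub_cancel, Polynomial.eval_zero] at this
    exact hy this.symm
  have hc0 : c ≠ 0 := by
    rintro rfl
    have := hc 0
    simp only [zero_smul, add_zero, Polynomial.eval_zero, evalAt, MvPolynomial.eval_X] at this
    exact hl this.symm
  obtain ⟨t, ht⟩ : ∃ t, (a * b * c).eval t ≠ 0 := by
    by_contra! h
    exact mul_ne_zero (mul_ne_zero ha0 hb0) hc0 (Polynomial.funext fun t => by simp [h t])
  simp only [Polynomial.eval_mul, ha, hb, hc, mul_ne_zero_iff] at ht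
  have hv : x.rep + t • (y.rep - x.rep) ≠ 0 := by
    intro h0
    exact ht.2 (by simp [h0, evalAt])
  exact ⟨Projectivization.mk ℂ _ hv, (mk_mem_basicOpen hP _ hv).2 ht.1.1,
    (mk_mem_basicOpen hQ _ hv).2 ht.1.2⟩

theorem dense_basicOpen {P : MvPolynomial (Module.Dual ℂ M) ℂ} {d : ℕ} (hP : P.IsHomogeneous d)
    (h : (basicOpen P).Nonempty) : @Dense _ (zariskiTopology M) (basicOpen P) := by
  let _ := zariskiTopology M
  rw [isTopologicalBasis_basicOpen.dense_iff]
  rintro _ ⟨e, Q, hQ, rfl⟩ hne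
  exact basicOpen_inter_nonempty hQ hP hne h

end Zariski

/-! ### The derivative of the bracket -/

section Polar
variable {p : ℕ}

/-- The bilinear map `(A, B) ↦ AJB - BJA`. -/
def bracketBilin (p : ℕ) : SkewMat p →ₗ[ℂ] SkewMat p →ₗ[ℂ] SymMat p :=
  LinearMap.mk₂ ℂ (fun A B => phiLift p (A, B)) phiLift_add_left phiLift_smul_left
    phiLift_add_right phiLift_smul_right

/-- The derivative of `(A, B) ↦ AJB - BJA`. -/
def phiPolar (x : SkewMat p × SkewMat p) : SkewMat p × SkewMat p →ₗ[ℂ] SymMat p :=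
  (bracketBilin p x.1).comp (LinearMap.snd ℂ _ _) +
    ((bracketBilin p).flip x.2).comp (LinearMap.fst ℂ _ _)

theorem phiPolar_apply (x y : SkewMat p × SkewMat p) :
    phiPolar x y = phiLift p (x.1, y.2) + phiLift p (y.1, x.2) := rfl

attribute [local instance] Matrix.normedAddCommGroup Matrix.normedSpace

theorem hasStrictFDerivAt_bilinear {E F G : Type*} [NormedAddCommGroup E] [NormedSpace ℂ E]
    [FiniteDimensional ℂ E] [NormedAddCommGroup F] [NormedSpace ℂ F] [FiniteDimensional ℂ F]
    [NormedAddCommGroup G] [NormedSpace ℂ G] (f : E →ₗ[ℂ] F →ₗ[ℂ] G) (x : E × F) :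
    HasStrictFDerivAt (fun y : E × F => f y.1 y.2) (LinearMap.toContinuousLinearMap
      ((f x.1).comp (LinearMap.snd ℂ _ _) + (f.flip x.2).comp (LinearMap.fst ℂ _ _))) x := by
  refine (f.toContinuousBilinearMap.isBoundedBilinearMap.hasStrictFDerivAt x).congr_fderiv ?_
  refine ContinuousLinearMap.ext fun y => ?_
  simp [IsBoundedBilinearMap.deriv, ContinuousLinearMap.deriv₂]

theorem hasStrictFDerivAt_phiLift (x : SkewMat p × SkewMat p) :
    HasStrictFDerivAt (phiLift p) (LinearMap.toContinuousLinearMap (phiPolar x)) x :=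
  hasStrictFDerivAt_bilinear (bracketBilin p) x

theorem map_nhds_phiLift {x : SkewMat p × SkewMat p} (hx : Function.Surjective (phiPolar x)) :
    Filter.map (phiLift p) (𝓝 x) = 𝓝 (phiLift p x) :=
  (hasStrictFDerivAt_phiLift x).map_nhds_eq_of_surj (LinearMap.range_eq_top.2 hx)

end Polar

theorem isSubmersiveAt_of_surjective {p : ℕ} {x : SkewMat p × SkewMat p}
    (hx : Function.Surjective (phiPolar x)) : IsSubmersiveAt p x := by
  rw [IsSubmersiveAt, (hasStrictFDerivAt_phiLift x).hasFDerivAt.fderiv]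
  exact hx

/-! ### n ≥ 8: a pair with trivial commutant -/

section Commutant
variable {p : ℕ}

/-- The off-diagonal block of `skewPartner`. -/
def partnerOff (p : ℕ) : Matrix (Fin p) (Fin p) ℂ := Matrix.of fun i j =>
  if (i.val = 0 ∧ j.val ≠ 0) ∨ (i.val ≠ 0 ∧ j.val = 0) then -1
  else if i.val = 1 ∧ j.val = 2 then 1
  else if i.val = 2 ∧ j.val = 1 then -1
  else 0

/-- The diagonal block of `skewPartner`. -/
def partnerDiag (p : ℕ) : Matrix (Fin p) (Fin p) ℂ := Matrix.of fun i j =>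
  if i.val = 1 ∧ j.val = 3 then 1
  else if i.val = 3 ∧ j.val = 1 then -1
  else 0

theorem partnerDiag_transpose : (partnerDiag p)ᵀ = -partnerDiag p := by
  ext i j
  simp only [partnerDiag, transpose_apply, of_apply, Matrix.neg_apply]
  split_ifs <;> first | omega | simp

/-- A skew-symmetric matrix which, for `p ≥ 4`, forms with `skewDiag` a pair at which
`(A, B) ↦ AJB - BJA` is submersive. -/
def skewPartner (p : ℕ) : Matrix (Idx p) (Idx p) ℂ :=
  fromBlocks (partnerDiag p) (partnerOff p) (-(partnerOff p)ᵀ) (-partnerDiag p)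

theorem skewPartner_transpose : (skewPartner p)ᵀ = -skewPartner p := by
  simp [skewPartner, fromBlocks_transpose, fromBlocks_neg, partnerDiag_transpose]

/-- Index 0 is linked to every other index, so each qₖ is constant. The entries at (1, 2), skew in
the off-diagonal block, then kill q₁ and q₃; the entry at (1, 3) of the diagonal block kills q₂.
This is where p ≥ 4 enters. -/
theorem eq_zero_of_commute (hp : 4 ≤ p) {q₁ q₂ q₃ : Fin p → ℂ}
    (h : fromBlocks (diagonal q₁) (diagonal q₂) (diagonal q₂) (diagonal q₃) * skewPartner p *
      stdJ p = stdJ p * skewPartner p *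
        fromBlocks (diagonal q₁) (diagonal q₂) (diagonal q₂) (diagonal q₃)) :
    q₁ = 0 ∧ q₂ = 0 ∧ q₃ = 0 := by
  simp only [skewPartner, stdJ, fromBlocks_multiply, fromBlocks_inj] at h
  obtain ⟨h11, h12, -, h22⟩ := h
  have e11 := fun i j => congrFun (congrFun h11 i) j
  have e12 := fun i j => congrFun (congrFun h12 i) j
  have e22 := fun i j => congrFun (congrFun h22 i) j
  simp [-diagonal_mul_diagonal] at e11 e12 e22
  have c (j : Fin p) : q₁ ⟨0, by omega⟩ = q₁ j ∧ q₂ ⟨0, by omega⟩ = q₂ j ∧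
      q₃ ⟨0, by omega⟩ = q₃ j := by
    by_cases hj : j.val = 0
    · have h0 : ⟨0, by omega⟩ = j := Fin.ext hj.symm
      rw [h0]
      exact ⟨rfl, rfl, rfl⟩
    · have h1 := e11 ⟨0, by omega⟩ j
      have h2 := e12 ⟨0, by omega⟩ j
      have h3 := e22 ⟨0, by omega⟩ j
      simp [partnerOff, partnerDiag, hj] at h1 h2 h3
      exact ⟨h1, h2, h3⟩
  have h1 := e11 ⟨1, by omega⟩ ⟨2, by omega⟩
  have h3 := e22 ⟨1, by omega⟩ ⟨2, by omega⟩
  have h2 := e11 ⟨1, by omega⟩ ⟨3, by omega⟩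
  simp [partnerOff, partnerDiag, ← (c _).1, ← (c _).2.1, ← (c _).2.2] at h1 h2 h3
  have z1 : q₁ ⟨0, by omega⟩ = 0 := by linear_combination (-1 / 2) * h1
  have z2 : q₂ ⟨0, by omega⟩ = 0 := by linear_combination (1 / 2) * h2
  have z3 : q₃ ⟨0, by omega⟩ = 0 := by linear_combination (1 / 2) * h3
  refine ⟨funext fun j => ?_, funext fun j => ?_, funext fun j => ?_⟩
  · rw [← (c j).1, z1, Pi.zero_apply]
  · rw [← (c j).2.1, z2, Pi.zero_apply]
  · rw [← (c j).2.2, z3, Pi.zero_apply]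

/-- The matrix `skewDiag` with entries `0, 1, …, p - 1`. -/
def skewBase (p : ℕ) : Matrix (Idx p) (Idx p) ℂ := skewDiag fun i => (i.val : ℂ)

theorem eq_zero_of_commute_pair (hp : 4 ≤ p) {Q : Matrix (Idx p) (Idx p) ℂ} (hQ : Qᵀ = Q)
    (hA : Q * skewBase p * stdJ p = stdJ p * skewBase p * Q)
    (hB : Q * skewPartner p * stdJ p = stdJ p * skewPartner p * Q) : Q = 0 := by
  -- The first condition says that Q commutes with a diagonal matrix separating the hyperbolic
  -- planes, so Q has diagonal blocks.
  rw [skewBase, Matrix.mul_assoc, skewDiag_mul_stdJ, stdJ_mul_skewDiag] at hA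
  have key (i j : Idx p) (hij : Sum.elim id id i ≠ Sum.elim id id j) : Q i j = 0 := by
    have h := congrFun (congrFun hA i) j
    simp only [Matrix.mul_neg, Matrix.neg_mul, Matrix.neg_apply, mul_diagonal, diagonal_mul] at h
    have h' : (Sum.elim (fun i : Fin p => (i.val : ℂ)) (fun i => (i.val : ℂ)) i -
        Sum.elim (fun i : Fin p => (i.val : ℂ)) (fun i => (i.val : ℂ)) j) * Q i j = 0 := by
      linear_combination h
    refine (mul_eq_zero.1 h').resolve_left fun h0 => hij ?_
    rw [sub_eq_zero] at h0
    rcases i with i | i <;> rcases j with j | j <;>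
      simpa [Fin.ext_iff] using h0
  obtain ⟨q₁, q₂, q₃, rfl⟩ : ∃ q₁ q₂ q₃ : Fin p → ℂ,
      Q = fromBlocks (diagonal q₁) (diagonal q₂) (diagonal q₂) (diagonal q₃) := by
    refine ⟨fun i => Q (.inl i) (.inl i), fun i => Q (.inl i) (.inr i),
      fun i => Q (.inr i) (.inr i), ?_⟩
    ext i j
    have hs (i j) : Q i j = Q j i := congrFun (congrFun hQ j) i
    by_cases hij : Sum.elim id id i = Sum.elim id id j
    · rcases i with i | i <;> rcases j with j | j <;> simp at hij <;> subst hij <;> simp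
      exact hs _ _
    · rw [key i j hij]
      rcases i with i | i <;> rcases j with j | j <;> simp at hij <;> simp [hij]
  obtain ⟨h1, h2, h3⟩ := eq_zero_of_commute hp hB
  simp [h1, h2, h3]

theorem bracket_base_partner_apply (hp : 4 ≤ p) :
    (skewBase p * stdJ p * skewPartner p - skewPartner p * stdJ p * skewBase p)
      (.inl ⟨0, by omega⟩) (.inr ⟨1, by omega⟩) = -1 := by
  rw [skewBase, bracket_skewDiag_apply]
  simp [skewPartner, partnerOff]

end Commutant

/-! ### Trace duality and surjectivity of the derivative -/

section Surjective
variable {p : ℕ}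

/-- Symmetrization `M ↦ M + Mᵀ`. -/
def symmetrize (p : ℕ) : Matrix (Idx p) (Idx p) ℂ →ₗ[ℂ] SymMat p where
  toFun M := ⟨M + Mᵀ, show (M + Mᵀ)ᵀ = _ by rw [transpose_add, transpose_transpose, add_comm]⟩
  map_add' M N := Subtype.ext (by simp; abel)
  map_smul' c M := Subtype.ext (by simp)

/-- Q records the values of f on Eᵢⱼ + Eⱼᵢ, whence the factor 2. -/
theorem exists_trace_form (f : Module.Dual ℂ (SymMat p)) :
    ∃ Q : Matrix (Idx p) (Idx p) ℂ, Qᵀ = Q ∧ ∀ S : SymMat p, 2 * f S = (S.1 * Q).trace := by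
  refine ⟨Matrix.of fun i j => f (symmetrize p (single i j 1)), ?_, fun S => ?_⟩
  · ext i j
    simp only [transpose_apply, of_apply]
    congr 1
    apply Subtype.ext
    simp [symmetrize, add_comm]
  · have h : symmetrize p S.1 = (2 : ℂ) • S := by
      apply Subtype.ext
      have : (S.1)ᵀ = S.1 := S.2
      simp [symmetrize, this, two_smul]
    have hs (i j) : S.1 i j = S.1 j i := congrFun (congrFun S.2 j) i
    rw [← smul_eq_mul, ← map_smul, ← h, matrix_eq_sum_single S.1]
    simp only [map_sum, trace, diag_apply, mul_apply]
    rw [← matrix_eq_sum_single S.1]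
    refine Finset.sum_congr rfl fun i _ => Finset.sum_congr rfl fun j _ => ?_
    have : single i j (S.1 i j) = S.1 i j • single i j (1 : ℂ) := by simp
    rw [this, map_smul, map_smul, smul_eq_mul, of_apply]
    congr 2
    apply Subtype.ext
    simp [symmetrize, add_comm]

open scoped ComplexOrder in
-- The conjugate transpose of N is again skew; as a test matrix it gives tr(NᴴN) = 0.
theorem eq_zero_of_trace_skew {N : Matrix (Idx p) (Idx p) ℂ} (hN : Nᵀ = -N)
    (h : ∀ W : SkewMat p, (W.1 * N).trace = 0) : N = 0 := by
  rw [← trace_conjTranspose_mul_self_eq_zero_iff]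
  refine h ⟨Nᴴ, ?_⟩
  show (Nᴴ)ᵀ = -Nᴴ
  rw [← conjTranspose_neg, ← hN]
  rfl

/-- By cyclicity the trace is tr(W(QAJ - JAQ)), and QAJ - JAQ is itself skew. -/
theorem commute_of_trace_bracket {A Q : Matrix (Idx p) (Idx p) ℂ} (hA : Aᵀ = -A) (hQ : Qᵀ = Q)
    (h : ∀ W : SkewMat p, ((A * stdJ p * W.1 - W.1 * stdJ p * A) * Q).trace = 0) :
    Q * A * stdJ p = stdJ p * A * Q := by
  rw [← sub_eq_zero]
  apply eq_zero_of_trace_skew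
  · simp only [transpose_sub, transpose_mul, hA, hQ, stdJ_transpose]
    simp [Matrix.mul_assoc]
  · intro W
    rw [← h W, Matrix.mul_sub, Matrix.sub_mul, trace_sub, trace_sub]
    congr 1
    · rw [trace_mul_comm, ← trace_mul_comm Q]
      simp only [Matrix.mul_assoc]
    · simp only [Matrix.mul_assoc]

theorem phiPolar_surjective {x : SkewMat p × SkewMat p}
    (hx : ∀ Q : Matrix (Idx p) (Idx p) ℂ, Qᵀ = Q → Q * x.1.1 * stdJ p = stdJ p * x.1.1 * Q →
      Q * x.2.1 * stdJ p = stdJ p * x.2.1 * Q → Q = 0) : Function.Surjective (phiPolar x) := by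
  rw [← LinearMap.range_eq_top]
  by_contra hlt
  obtain ⟨f, hf, hle⟩ := Submodule.exists_le_ker_of_lt_top _ (lt_top_iff_ne_top.2 hlt)
  obtain ⟨Q, hQ, hfQ⟩ := exists_trace_form f
  have hz (y) : f (phiPolar x y) = 0 := hle ⟨y, rfl⟩
  have hQ0 : Q = 0 := by
    refine hx Q hQ (commute_of_trace_bracket x.1.2 hQ fun W => ?_)
      (commute_of_trace_bracket x.2.2 hQ fun W => ?_)
    · have := hfQ (phiPolar x (0, W))
      rw [hz, mul_zero] at this
      rw [this]
      simp [phiPolar_apply, phiLift]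
    · have := hfQ (phiPolar x (W, 0))
      rw [hz, mul_zero] at this
      rw [← neg_eq_zero, ← trace_neg, this, ← Matrix.neg_mul, neg_sub]
      simp [phiPolar_apply, phiLift]
  refine hf (LinearMap.ext fun S => ?_)
  have := hfQ S
  rw [hQ0] at this
  simpa using this

theorem exists_phiPolar_surjective (hp : 4 ≤ p) :
    ∃ x : SkewMat p × SkewMat p, Function.Surjective (phiPolar x) ∧ phiLift p x ≠ 0 := by
  refine ⟨(⟨skewBase p, skewDiag_transpose _⟩, ⟨skewPartner p, skewPartner_transpose⟩),
    phiPolar_surjective fun Q hQ hA hB => eq_zero_of_commute_pair hp hQ hA hB, fun h => ?_⟩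
  have h1 := bracket_base_partner_apply hp
  rw [show skewBase p * stdJ p * skewPartner p - skewPartner p * stdJ p * skewBase p = 0 from
    congrArg Subtype.val h] at h1
  simp at h1

end Surjective

/-! ### From one submersive point to a dense open set, and dominance -/

section Generic
variable {p : ℕ}

theorem isHomogeneous_det_X {n σ R : Type*} [Fintype n] [DecidableEq n] [CommRing R]
    (l : n → n → σ) :
    (Matrix.of fun i j => (MvPolynomial.X (l i j) : MvPolynomial σ R)).det.IsHomogeneous
      (Fintype.card n) := by
  rw [Matrix.det_apply]
  refine MvPolynomial.IsHomogeneous.sum _ _ _ fun τ _ => ?_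
  have h : (∏ i, (Matrix.of fun i j => (MvPolynomial.X (l i j) : MvPolynomial σ R))
      (τ i) i).IsHomogeneous (Fintype.card n) := by
    simpa using MvPolynomial.IsHomogeneous.prod Finset.univ
      (fun i => (MvPolynomial.X (l (τ i) i) : MvPolynomial σ R)) (fun _ => 1)
      fun i _ => MvPolynomial.isHomogeneous_X _ _
  rcases Int.units_eq_one_or (Equiv.Perm.sign τ) with hτ | hτ
  · simpa [hτ] using h
  · simpa [hτ] using h.neg

/-- Fix a right inverse R of the derivative at x₀. The determinant of the derivative at x composed
with R is a form in x, equal to 1 at x₀, and its nonvanishing implies surjectivity. -/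
theorem exists_polynomial_surjective {x₀ : SkewMat p × SkewMat p}
    (h₀ : Function.Surjective (phiPolar x₀)) :
    ∃ (d : ℕ) (P : MvPolynomial (Module.Dual ℂ (SkewMat p × SkewMat p)) ℂ),
      P.IsHomogeneous d ∧ evalAt x₀ P ≠ 0 ∧
        ∀ x, evalAt x P ≠ 0 → Function.Surjective (phiPolar x) := by
  obtain ⟨R, hR⟩ := (phiPolar x₀).exists_rightInverse_of_surjective (LinearMap.range_eq_top.2 h₀)
  let b := Module.finBasis ℂ (SymMat p)
  let l (i j) : Module.Dual ℂ (SkewMat p × SkewMat p) :=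
    b.coord i ∘ₗ LinearMap.flip (LinearMap.mk₂ ℂ (fun x y => phiPolar x y)
      (fun x x' y => by simp only [phiPolar_apply, Prod.fst_add, Prod.snd_add, phiLift_add_left, phiLift_add_right]; abel)
      (fun c x y => by simp only [phiPolar_apply, Prod.smul_fst, Prod.smul_snd, phiLift_smul_left, phiLift_smul_right, smul_add])
      (fun x y y' => map_add _ _ _) (fun c x y => map_smul _ _ _)) (R (b j))
  let P : MvPolynomial (Module.Dual ℂ (SkewMat p × SkewMat p)) ℂ :=
    (Matrix.of fun i j => MvPolynomial.X (l i j)).det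
  have key (x) : evalAt x P = LinearMap.det (phiPolar x ∘ₗ R) := by
    rw [← LinearMap.det_toMatrix b, RingHom.map_det]
    congr 1
    ext i j
    simp [evalAt, l, LinearMap.toMatrix_apply]
  refine ⟨_, P, isHomogeneous_det_X l, ?_, fun x hx => ?_⟩
  · rw [key, hR]
    simp
  · rw [key] at hx
    have := (LinearMap.equivOfDetNeZero _ hx).surjective
    exact Function.Surjective.of_comp (g := R) this

/-- The entries of `AJB - BJA` as polynomials in linear forms on the space of pairs. -/
def bracketEntry (p : ℕ) (i j : Idx p) : MvPolynomial (Module.Dual ℂ (SkewMat p × SkewMat p)) ℂ :=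
  let a (k l) : Module.Dual ℂ (SkewMat p × SkewMat p) := Matrix.entryLinearMap ℂ ℂ k l ∘ₗ
    (SkewMat p).subtype ∘ₗ LinearMap.fst ℂ _ _
  let b (k l) : Module.Dual ℂ (SkewMat p × SkewMat p) := Matrix.entryLinearMap ℂ ℂ k l ∘ₗ
    (SkewMat p).subtype ∘ₗ LinearMap.snd ℂ _ _
  ∑ l, ∑ k, MvPolynomial.C (stdJ p k l) * (MvPolynomial.X (a i k) * MvPolynomial.X (b l j) -
    MvPolynomial.X (b i k) * MvPolynomial.X (a l j))

theorem isHomogeneous_bracketEntry (i j : Idx p) : (bracketEntry p i j).IsHomogeneous 2 := by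
  refine MvPolynomial.IsHomogeneous.sum _ _ _ fun l _ =>
    MvPolynomial.IsHomogeneous.sum _ _ _ fun k _ => ?_
  have hX := fun l : Module.Dual ℂ (SkewMat p × SkewMat p) => MvPolynomial.isHomogeneous_X ℂ l
  simpa using (MvPolynomial.isHomogeneous_C _ (stdJ p k l)).mul
    (((hX _).mul (hX _)).sub ((hX _).mul (hX _)))

theorem evalAt_bracketEntry (i j : Idx p) (x : SkewMat p × SkewMat p) :
    evalAt x (bracketEntry p i j) = (phiLift p x).1 i j := by
  simp only [evalAt, bracketEntry, phiLift, Matrix.sub_apply, mul_apply, Finset.sum_mul,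
    ← Finset.sum_sub_distrib, map_sum]
  refine Finset.sum_congr rfl fun l _ => Finset.sum_congr rfl fun k _ => ?_
  simp
  ring

theorem exists_open_submersive (hp : 4 ≤ p) :
    ∃ U : Set (ℙ ℂ (SkewMat p × SkewMat p)),
      IsOpen[zariskiTopology (SkewMat p × SkewMat p)] U ∧
      @Dense _ (zariskiTopology (SkewMat p × SkewMat p)) U ∧
      U ⊆ (phi p).Dom ∧
      ∀ (x : SkewMat p × SkewMat p) (hx : x ≠ 0),
        Projectivization.mk ℂ x hx ∈ U → IsSubmersiveAt p x := by
  obtain ⟨x₀, hs, h0⟩ := exists_phiPolar_surjective hp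
  obtain ⟨d, P, hP, hP0, hPs⟩ := exists_polynomial_surjective hs
  obtain ⟨i, j, hij⟩ : ∃ i j, (phiLift p x₀).1 i j ≠ 0 := by
    by_contra! h
    exact h0 (Subtype.ext (Matrix.ext h))
  have hx0 : x₀ ≠ 0 := by
    rintro rfl
    exact h0 (Subtype.ext (by simp [phiLift]))
  have hPQ := hP.mul (isHomogeneous_bracketEntry (p := p) i j)
  have hev (x) : evalAt x (P * bracketEntry p i j) ≠ 0 ↔
      evalAt x P ≠ 0 ∧ (phiLift p x).1 i j ≠ 0 := by
    rw [map_mul, evalAt_bracketEntry, mul_ne_zero_iff]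
  refine ⟨basicOpen (P * bracketEntry p i j), isOpen_basicOpen hPQ, dense_basicOpen hPQ
    ⟨Projectivization.mk ℂ x₀ hx0, ?_⟩, fun y hy => ?_, fun x hx hxU => ?_⟩
  · exact (mk_mem_basicOpen hPQ _ _).2 ((hev _).2 ⟨hP0, hij⟩)
  · have h := ((hev _).1 hy).2
    rw [← y.mk_rep, mem_dom_phi_mk]
    intro h'
    exact h (by rw [h']; rfl)
  · exact isSubmersiveAt_of_surjective (hPs x ((hev _).1 ((mk_mem_basicOpen hPQ _ _).1 hxU)).1)

/-- Surjectivity at x₀ makes the image of the affine map a classical neighbourhood of its value. A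
form vanishing on the image then vanishes near that value, hence identically on each line through
it. -/
theorem dense_ran_phi (hp : 4 ≤ p) : @Dense _ (zariskiTopology (SymMat p)) (phi p).ran := by
  obtain ⟨x₀, hs, h0⟩ := exists_phiPolar_surjective hp
  let _ := zariskiTopology (SymMat p)
  rw [isTopologicalBasis_basicOpen.dense_iff]
  rintro _ ⟨e, Q, hQ, rfl⟩ ⟨y, hy⟩
  by_contra hemp
  have hvan (x) (hx : phiLift p x ≠ 0) : evalAt (phiLift p x) Q = 0 := by
    by_contra hne
    refine hemp ⟨Projectivization.mk ℂ (phiLift p x) hx, (mk_mem_basicOpen hQ _ _).2 hne, ?_⟩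
    exact (mem_ran_phi_mk _ _).2 ⟨x.1.1, x.2.1, x.1.2, x.2.2, rfl⟩
  obtain ⟨q, hq⟩ := exists_polynomial_line Q (phiLift p x₀) (y.rep - phiLift p x₀)
  have hnear : ∀ᶠ S in 𝓝 (phiLift p x₀), evalAt S Q = 0 := by
    have hr : Set.range (phiLift p) ∈ 𝓝 (phiLift p x₀) := by
      have := Filter.range_mem_map (f := 𝓝 x₀) (m := phiLift p)
      exact (map_nhds_phiLift hs) ▸ this
    filter_upwards [hr, isOpen_ne.mem_nhds h0]
    rintro _ ⟨x, rfl⟩ hx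
    exact hvan x hx
  have hline : ∀ᶠ t : ℂ in 𝓝 0, q.eval t = 0 := by
    have hc : Filter.Tendsto (fun t : ℂ => phiLift p x₀ + t • (y.rep - phiLift p x₀)) (𝓝 0)
        (𝓝 (phiLift p x₀)) := by
      have : Continuous (fun t : ℂ => phiLift p x₀ + t • (y.rep - phiLift p x₀)) := by fun_prop
      simpa using this.tendsto 0
    filter_upwards [hc.eventually hnear] with t ht
    rw [hq, ht]
  have hq0 : q = 0 := Polynomial.eq_zero_of_infinite_isRoot q (infinite_of_mem_nhds 0 hline)
  have := hq 1
  rw [hq0, one_smul, add_sub_cancel, Polynomial.eval_zero] at this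
  exact hy this.symm

end Generic

end

theorem proposition5p1 :
    -- `n = 2`: `φ` is defined nowhere
    (phi 1).Dom = ∅ ∧
    -- `n = 4`: the image is the Plücker-embedded Grassmannian `G(2,5)`
    (∃ e : (⋀[ℂ]^2 (Fin 5 → ℂ)) ≃ₗ[ℂ] SymMat 2,
      (phi 2).ran =
        Projectivization.map e.toLinearMap e.injective '' pluckerGrassmannian 2 5) ∧
    -- `n = 6`: the image is the irreducible quartic hypersurface `γ₄² - 4γ₂ = 0`
    ((gammaPoly 3 4 ^ 2 - 4 * gammaPoly 3 2).IsHomogeneous 4 ∧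
      Irreducible (gammaPoly 3 4 ^ 2 - 4 * gammaPoly 3 2) ∧
      (phi 3).ran = symZeroLocus 3 (gammaPoly 3 4 ^ 2 - 4 * gammaPoly 3 2)) ∧
    -- `n = 2p ≥ 8`: `φ` has maximal rank on a dense Zariski open set, and it is dominant
    (∀ p : ℕ, 4 ≤ p →
      (∃ U : Set (ℙ ℂ (SkewMat p × SkewMat p)),
        IsOpen[zariskiTopology (SkewMat p × SkewMat p)] U ∧
        @Dense _ (zariskiTopology (SkewMat p × SkewMat p)) U ∧
        U ⊆ (phi p).Dom ∧
        ∀ (x : SkewMat p × SkewMat p) (hx : x ≠ 0),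
          Projectivization.mk ℂ x hx ∈ U → IsSubmersiveAt p x) ∧
      @Dense _ (zariskiTopology (SymMat p)) (phi p).ran) :=
  ⟨dom_phi_one, exists_ran_phi_two, ⟨isHomogeneous_quartic, irreducible_quartic, ran_phi_three⟩,
    fun _ hp => ⟨exists_open_submersive hp, dense_ran_phi hp⟩⟩
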